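/- Let $\mathcal C$ be a modular tensor category over $\mathbb C$: a braided spherical fusion category (rigid, $\mathbb C$-linear, semisimple, finite-dimensional morphism spaces, finitely many simple objects up to isomorphism, each with endomorphism ring $\mathbb C$, simple unit object $I$) whose S-matrix is nonsingular. Let $X_i$, $i\in\Gamma$, be a complete set of pairwise nonisomorphic simple objects, where the S-matrix is, up to normalization, the matrix with entries $\mathrm{ptr}(c_{X_j,X_i^*}\circ c_{X_i^*,X_j})$, with $c$ the braiding and $\mathrm{ptr}$ the pivotal trace. Let $d_i=\mathrm{ptr}(\mathrm{id}_{X_i})$ be the pivotal dimension of $X_i$, $\dim\mathcal C=\sum_{i\in\Gamma}d(X_i)d(X_i^*)$, $N_{ik}^j=\dim\mathcal C(X_i\otimes X_k,X_j)$, and let $\omega_i\in\mathbb C$ be given by $\theta_{X_i}=\omega_i\,\mathrm{id}_{X_i}$, where $\theta=u^{-1}j$ is the twist associated with the pivotal structure $j$ and the Drinfeld isomorphism $u$ of $c$. For $n\ge 1$ and an object $V$, let $\nu_n(V)$ be the $n$-th Frobenius–Schur indicator, i.e. the trace of the linear operator $E_V^{(n)}$ on $\mathcal C(I,V^{\otimes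 n})$ that moves the first tensor factor to the last place by means of duality and the pivotal structure. Then for all $j\in\Gamma$ and all positive integers $n$, $$\nu_n(X_j)=\frac{1}{\dim\mathcal C}\sum_{i,k\in\Gamma}N_{ik}^j\,d_i\,d_k\left(\frac{\omega_i}{\omega_k}\right)^n .$$ In particular, if $N=\exp(\mathcal C)$ is the exponent of $\mathcal C$, i.e. the least positive integer such that $(c_{W,V}\circ c_{V,W})^N=\mathrm{id}_{V\otimes W}$ for all objects $V,W$ of the Drinfeld center $Z(\mathcal C)$ with its braiding $c$, then for all $j\in\Gamma$ $$\nu_N(X_j)=\omega_j^N d_j=\pm d_j .$$ -/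

import Mathlib

open CategoryTheory MonoidalCategory Limits

universe v u w

noncomputable section

namespace FrobSchur

/-! ## Pivotal and spherical categories

The dual `Vᘁ` comes with `ε_ V Vᘁ : Vᘁ ⊗ V ⟶ 𝟙_ C` and `η_ V Vᘁ : 𝟙_ C ⟶ V ⊗ Vᘁ`. Every object
has such a dual (`RightRigidCategory`); a pivotal structure then also provides the duals on the
other side. -/

/-- The canonical isomorphism `(V ⊗ W)ᘁᘁ ≅ Vᘁᘁ ⊗ Wᘁᘁ`, i.e. the monoidal structure of the double
dual functor: the dual of the inverse of `(V ⊗ W)ᘁ ≅ Wᘁ ⊗ Vᘁ`, followed by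
`(Wᘁ ⊗ Vᘁ)ᘁ ≅ Vᘁᘁ ⊗ Wᘁᘁ`. -/
def bidualTensor {C : Type u} [Category.{v} C] [MonoidalCategory C] [RightRigidCategory C]
    (V W : C) : ((V ⊗ W)ᘁ)ᘁ ⟶ (Vᘁ)ᘁ ⊗ (Wᘁ)ᘁ :=
  rightAdjointMate (rightDualTensorIso V W).inv ≫ (rightDualTensorIso (Wᘁ) (Vᘁ)).hom

/-- A pivotal category: an isomorphism `j : V ≅ Vᘁᘁ` of monoidal functors. (Compatibility with the
unit object is a consequence of `j_tensor`, since `j` is invertible.) -/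
class PivotalCategory (C : Type u) [Category.{v} C] [MonoidalCategory C]
    [RightRigidCategory C] where
  j : ∀ V : C, V ≅ (Vᘁ)ᘁ
  j_naturality : ∀ {V W : C} (f : V ⟶ W),
    f ≫ (j W).hom = (j V).hom ≫ rightAdjointMate (rightAdjointMate f)
  j_tensor : ∀ V W : C, (j (V ⊗ W)).hom ≫ bidualTensor V W = (j V).hom ⊗ₘ (j W).hom

section Pivotal

variable {C : Type u} [Category.{v} C] [MonoidalCategory C] [RightRigidCategory C]
  [PivotalCategory C]

/-- The right pivotal trace `𝟙 → V ⊗ Vᘁ → V ⊗ Vᘁ → Vᘁᘁ ⊗ Vᘁ → 𝟙`. -/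
def ptrR {V : C} (f : V ⟶ V) : 𝟙_ C ⟶ 𝟙_ C :=
  η_ V (Vᘁ) ≫ f ▷ Vᘁ ≫ (PivotalCategory.j V).hom ▷ Vᘁ ≫ ε_ (Vᘁ) ((Vᘁ)ᘁ)

/-- The left pivotal trace `𝟙 → Vᘁ ⊗ Vᘁᘁ → Vᘁ ⊗ V → Vᘁ ⊗ V → 𝟙`. -/
def ptrL {V : C} (f : V ⟶ V) : 𝟙_ C ⟶ 𝟙_ C :=
  η_ (Vᘁ) ((Vᘁ)ᘁ) ≫ Vᘁ ◁ (PivotalCategory.j V).inv ≫ Vᘁ ◁ f ≫ ε_ V (Vᘁ)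

end Pivotal

/-- A pivotal category is spherical if left and right pivotal traces agree. -/
class SphericalCategory (C : Type u) [Category.{v} C] [MonoidalCategory C]
    [RightRigidCategory C] [PivotalCategory C] : Prop where
  ptr_eq : ∀ {V : C} (f : V ⟶ V), ptrR f = ptrL f

/-! ## Fusion categories over `ℂ` -/

/-- `X i`, `i ∈ Γ`, is a complete set of pairwise nonisomorphic simple objects. -/
structure IsCompleteSimples {C : Type u} [Category.{v} C] [HasZeroMorphisms C] {Γ : Type w}
    (X : Γ → C) : Prop where
  simple : ∀ i, Simple (X i)
  eq_of_iso : ∀ i k, Nonempty (X i ≅ X k) → i = k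
  exists_iso : ∀ Y : C, Simple Y → ∃ i, Nonempty (Y ≅ X i)

attribute [local instance] Abelian.hasFiniteBiproducts

/-- A fusion category over `ℂ`: a rigid `ℂ`-linear abelian monoidal category with finite
dimensional morphism spaces, in which every object is a finite direct sum of simple objects, with
finitely many simple objects up to isomorphism, each with endomorphism ring `ℂ`, and with simple
unit object. -/
class FusionCategory (C : Type u) [Category.{v} C] [Abelian C] [Linear ℂ C] [MonoidalCategory C]
    [MonoidalPreadditive C] [MonoidalLinear ℂ C] [RightRigidCategory C] : Prop where
  finite_hom : ∀ V W : C, FiniteDimensional ℂ (V ⟶ W)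
  semisimple : ∀ V : C, ∃ (m : ℕ) (S : Fin m → C), (∀ a, Simple (S a)) ∧ Nonempty (V ≅ ⨁ S)
  finite_simples : ∃ (m : ℕ) (X : Fin m → C), IsCompleteSimples X
  finrank_end : ∀ V : C, Simple V → Module.finrank ℂ (V ⟶ V) = 1
  simple_unit : Simple (𝟙_ C)

/-- The scalar by which an endomorphism `f` of a simple object `V` acts, written as the trace of
composition with `f` on the one-dimensional space `End V`; see `eq_endScalar_smul`. -/
def endScalar {C : Type u} [Category.{v} C] [Preadditive C] [Linear ℂ C] {V : C} (f : V ⟶ V) : ℂ :=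
  LinearMap.trace ℂ (V ⟶ V) (Linear.rightComp ℂ V f)

/-- If `End V = ℂ`, then `f = (endScalar f) • 𝟙 V` for all endomorphisms `f` of `V`. -/
theorem eq_endScalar_smul {C : Type u} [Category.{v} C] [Preadditive C] [Linear ℂ C] {V : C}
    (h : Module.finrank ℂ (V ⟶ V) = 1) (f : V ⟶ V) : f = endScalar f • 𝟙 V := by
  have hne : 𝟙 V ≠ 0 := by
    intro h0
    have : Subsingleton (V ⟶ V) :=
      ⟨fun a b => by rw [← Category.id_comp a, ← Category.id_comp b, h0]; simp⟩
    rw [Module.finrank_zero_of_subsingleton] at h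
    exact zero_ne_one h
  obtain ⟨c, hc⟩ := (finrank_eq_one_iff_of_nonzero' (𝟙 V) hne).mp h f
  have key : Linear.rightComp ℂ V f = c • LinearMap.id := by
    ext g
    simp [← hc]
  have : FiniteDimensional ℂ (V ⟶ V) := Module.finite_of_finrank_eq_succ h
  rw [endScalar, key, map_smul, LinearMap.trace_id, h]
  simpa using hc.symm

section Dimensions

variable {C : Type u} [Category.{v} C] [Preadditive C] [Linear ℂ C] [MonoidalCategory C]
  [RightRigidCategory C] [PivotalCategory C]

/-- The pivotal dimension `d(V) ∈ ℂ = End 𝟙`. -/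
def pdim (V : C) : ℂ := endScalar (ptrR (𝟙 V))

/-- `dim C = ∑ᵢ d(Xᵢ) d(Xᵢᘁ)`. -/
def globalDim {Γ : Type w} [Fintype Γ] (X : Γ → C) : ℂ := ∑ i, pdim (X i) * pdim (X i)ᘁ

/-- `N_{ik}^j = dim Hom(Xᵢ ⊗ X_k, X_j)`. -/
def fusionCoeff {Γ : Type w} (X : Γ → C) (i k j : Γ) : ℕ :=
  Module.finrank ℂ (X i ⊗ X k ⟶ X j)

end Dimensions

/-! ## Higher Frobenius-Schur indicators -/

section Indicators

/-- The tensor power `V^{⊗ n}`, bracketed to the right. -/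
def tpow {C : Type u} [Category.{v} C] [MonoidalCategory C] (V : C) : ℕ → C
  | 0 => 𝟙_ C
  | n + 1 => V ⊗ tpow V n

/-- The coherence isomorphism `V^{⊗ n} ⊗ V ≅ V ⊗ V^{⊗ n}` that changes only the brackets. -/
def tpowShift {C : Type u} [Category.{v} C] [MonoidalCategory C] (V : C) :
    ∀ n : ℕ, tpow V n ⊗ V ≅ V ⊗ tpow V n
  | 0 => λ_ V ≪≫ (ρ_ V).symm
  | n + 1 => α_ V (tpow V n) V ≪≫ whiskerLeftIso V (tpowShift V n)

variable {C : Type u} [Category.{v} C] [Preadditive C] [Linear ℂ C] [MonoidalCategory C]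
  [MonoidalPreadditive C] [MonoidalLinear ℂ C] [RightRigidCategory C] [PivotalCategory C]

/-- The rotation `Hom(𝟙, V ⊗ W) → Hom(𝟙, W ⊗ V)`: `f` is sent to
`𝟙 → Vᘁ ⊗ Vᘁᘁ → Vᘁ ⊗ V → Vᘁ ⊗ ((V ⊗ W) ⊗ V) → (Vᘁ ⊗ V) ⊗ (W ⊗ V) → W ⊗ V`, composed of the
coevaluation of `Vᘁ`, the inverse of the pivotal structure, `f`, and the evaluation of `V`. -/
def rotate (V W : C) : (𝟙_ C ⟶ V ⊗ W) →ₗ[ℂ] (𝟙_ C ⟶ W ⊗ V) where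
  toFun f := η_ (Vᘁ) ((Vᘁ)ᘁ) ≫ Vᘁ ◁ (PivotalCategory.j V).inv ≫ Vᘁ ◁ (λ_ V).inv ≫
    Vᘁ ◁ (f ▷ V) ≫ Vᘁ ◁ (α_ V W V).hom ≫ (α_ (Vᘁ) V (W ⊗ V)).inv ≫
    ε_ V (Vᘁ) ▷ (W ⊗ V) ≫ (λ_ (W ⊗ V)).hom
  map_add' f g := by
    simp only [MonoidalPreadditive.add_whiskerRight, MonoidalPreadditive.whiskerLeft_add,
      Preadditive.add_comp, Preadditive.comp_add]
  map_smul' r f := by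
    simp only [MonoidalLinear.smul_whiskerRight, MonoidalLinear.whiskerLeft_smul,
      Linear.smul_comp, Linear.comp_smul, RingHom.id_apply]

/-- The operator `E_V^{(n)}` on `Hom(𝟙, V^{⊗ n})`: it moves the first tensor factor to the last
place (for `n = 0` it is the identity). -/
def fsOperator (V : C) : ∀ n : ℕ, (𝟙_ C ⟶ tpow V n) →ₗ[ℂ] (𝟙_ C ⟶ tpow V n)
  | 0 => LinearMap.id
  | n + 1 => Linear.rightComp ℂ (𝟙_ C) (tpowShift V n).hom ∘ₗ rotate V (tpow V n)

/-- The `n`-th Frobenius-Schur indicator `ν_n(V) = Tr E_V^{(n)}`. -/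
def fsIndicator (n : ℕ) (V : C) : ℂ := LinearMap.trace ℂ (𝟙_ C ⟶ tpow V n) (fsOperator V n)

end Indicators

/-! ## The twist, the S-matrix and the exponent -/

/-- The monodromy `M_{V,W} = c_{W,V} ∘ c_{V,W}`. -/
def monodromy {C : Type u} [Category.{v} C] [MonoidalCategory C] [BraidedCategory C] (V W : C) :
    End (V ⊗ W) :=
  (β_ V W).hom ≫ (β_ W V).hom

/-- The exponent of a monoidal category: the order of the monodromy of its Drinfeld center, i.e.
the least positive integer `n` such that `(c_{W,V} ∘ c_{V,W})^n = id` for all objects `V`, `W` of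
the center; `⊤` if there is none. -/
def exponent (C : Type u) [Category.{v} C] [MonoidalCategory C] : ℕ∞ :=
  ⨅ n ∈ {n : ℕ | 0 < n ∧ ∀ V W : Center C, monodromy V W ^ n = 1}, (n : ℕ∞)

section Braided

variable {C : Type u} [Category.{v} C] [MonoidalCategory C] [BraidedCategory C]
  [RightRigidCategory C]

/-- The Drinfeld isomorphism `u_V : V ⟶ Vᘁᘁ`. -/
def drinfeld (V : C) : V ⟶ (Vᘁ)ᘁ :=
  (λ_ V).inv ≫ η_ (Vᘁ) ((Vᘁ)ᘁ) ▷ V ≫ (α_ (Vᘁ) ((Vᘁ)ᘁ) V).hom ≫ Vᘁ ◁ (β_ V ((Vᘁ)ᘁ)).inv ≫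
    (α_ (Vᘁ) V ((Vᘁ)ᘁ)).inv ≫ ε_ V (Vᘁ) ▷ (Vᘁ)ᘁ ≫ (λ_ ((Vᘁ)ᘁ)).hom

/-- `u_V` compares two duals of `Vᘁ`, namely `V` (through the braiding) and `Vᘁᘁ`. -/
theorem drinfeld_eq (V : C) : drinfeld V =
    (rightDualIso (HasRightDual.exact (X := Vᘁ))
      (BraidedCategory.exactPairing_swap V (Vᘁ))).inv := by
  have h : (λ_ V).inv ≫ η_ (Vᘁ) ((Vᘁ)ᘁ) ▷ V =
      (ρ_ V).inv ≫ V ◁ η_ (Vᘁ) ((Vᘁ)ᘁ) ≫ (β_ V (Vᘁ ⊗ (Vᘁ)ᘁ)).hom := by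
    rw [BraidedCategory.braiding_naturality_right]
    simp
  change _ = (ρ_ V).inv ≫ V ◁ η_ (Vᘁ) ((Vᘁ)ᘁ) ≫ V ◁ (𝟙 (Vᘁ)) ▷ ((Vᘁ)ᘁ) ≫
    (α_ V (Vᘁ) ((Vᘁ)ᘁ)).inv ≫ ((β_ V (Vᘁ)).hom ≫ ε_ V (Vᘁ)) ▷ (Vᘁ)ᘁ ≫ (λ_ ((Vᘁ)ᘁ)).hom
  rw [drinfeld, ← Category.assoc, h, BraidedCategory.braiding_tensor_right_hom]
  simp

instance isIso_drinfeld (V : C) : IsIso (drinfeld V) := by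
  rw [drinfeld_eq]
  infer_instance

/-- The twist `θ = u⁻¹ j` associated with the pivotal structure `j`. -/
def twist [PivotalCategory C] (V : C) : V ⟶ V := (PivotalCategory.j V).hom ≫ inv (drinfeld V)

/-- The (unnormalized) S-matrix: its entries are the traces of the monodromies
`M_{Xᵢᘁ, X_j}`. -/
def sMatrix [Preadditive C] [Linear ℂ C] [PivotalCategory C] {Γ : Type w} (X : Γ → C) :
    Matrix Γ Γ ℂ :=
  Matrix.of fun i j => endScalar (ptrR (monodromy (X i)ᘁ (X j)))

end Braided

/-- The scalar `ω` with `θ_V = ω • 𝟙 V`, for a simple object `V`. -/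
def twistScalar {C : Type u} [Category.{v} C] [MonoidalCategory C] [BraidedCategory C]
    [RightRigidCategory C] [PivotalCategory C] [Preadditive C] [Linear ℂ C] (V : C) : ℂ :=
  endScalar (twist V)

/-- A modular tensor category: a braided spherical fusion category over `ℂ` whose S-matrix,
with respect to any complete set of nonisomorphic simple objects, is nonsingular. -/
class ModularTensorCategory (C : Type u) [Category.{v} C] [Abelian C] [Linear ℂ C]
    [MonoidalCategory C] [MonoidalPreadditive C] [MonoidalLinear ℂ C] [BraidedCategory C]
    [RightRigidCategory C] [PivotalCategory C] : Prop
    extends FusionCategory C, SphericalCategory C where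
  nonsingular : ∀ (m : ℕ) (X : Fin m → C), IsCompleteSimples X → IsUnit (sMatrix X)

end FrobSchur

end

/-!
Composites are read from left to right and `c` is the braiding. All traces are left pivotal traces;
`trL V f` closes the strand `V` of `f : V ⊗ A ⟶ V ⊗ B`.

*The rotation is a braid.* In a braided pivotal category the rotation of `f : 𝟙 ⟶ V ⊗ W` is
`f ≫ (θ_V ▷ W) ≫ c_{V,W}`, where `θ_V = trL V c_{V,V}` (`rotate_eq`). So for `V = X j` the operator
`E_V^{(n)}` is a twist scalar times composition with the braid that moves the first of `n` strands
to the last place.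

*Traces on `Hom(𝟙, A)` by surgery.* The element `∑ₖ d(X_k^*) X_k` absorbs every object at the cost
of its dimension (`kirbyScalar_mul`), and the S-matrix is invertible, so encircling a simple object
with this element gives `0`, except for the unit object, where it gives `dim C`
(`kirbyScalar_eq_zero`). Since a cyclic linear functional on endomorphisms is determined by its
values on the simple objects (`TraceFunctional.eq_sum`), it follows that `dim C` times the trace of
`φ` on `Hom(𝟙, A)` is `∑ₖ d(X_k^*)` times the pivotal trace of `φ` encircled by `X_k`
(`kirbyTrace_apply`). If `dim C` were `0`, these scalars would all vanish, which is a linear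
relation between the rows of the S-matrix; so `dim C ≠ 0` (`globalDim_ne_zero`).

*Straightening the closed braid.* The closure of the rotating braid on `n` strands `V`, encircled by
`X_k`, is one strand: a curve that winds `n` times around the circle `X_k` while going once along
it. Closing the strands one at a time replaces it by the closure of the `n`-th power of the
monodromy `M_{V,X_k}`, with one twist for each removed strand (`trL_monodromy_comp_shiftBraid`,
`ptrL_rotation_closure`). By balancing, `θ_{V ⊗ W} = (θ_V ⊗ θ_W) M_{V,W}` (`twistL_tensor`), this
monodromy is `ω_l / (ω_j ω_k)` on the constituents `X_l` of `X_j ⊗ X_k`. The powers of `ω_j` cancel,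
and replacing `X_k` by its dual gives the formula, because `ω_{k^*} = ω_k`.

*Where sphericality enters.* The operators `θ_V` are related to the twist of the statement, and to
the twist of the dual, only through the equality of left and right dimensions (`twistL_eq_smul`,
`twistScalar_dual`).

*The exponent.* A braided category maps to its Drinfeld center, so `M ^ N = 1` for `N` the exponent;
by balancing `ω_i ^ N ω_k ^ N = ω_j ^ N` whenever `X_j` occurs in `X_i ⊗ X_k`. Then all ratios in
the formula may be replaced by `ω_j ^ N`, and the case of the unit in `X_j^* ⊗ X_j` gives
`ω_j ^ {2N} = 1`.
-/

noncomputable section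

namespace FrobSchur

/-! ### The left partial trace of a pivotal category -/

section PartialTrace

variable {C : Type u} [Category.{v} C] [MonoidalCategory C] [RightRigidCategory C]

theorem rightDualTensorIso_inv_comp_eval (V W : C) :
    (rightDualTensorIso V W).inv ▷ (V ⊗ W) ≫ ε_ (V ⊗ W) ((V ⊗ W)ᘁ) =
      ε_ (V ⊗ W) (Wᘁ ⊗ Vᘁ) := by
  have := @rightAdjointMate_comp_evaluation C _ _ (V ⊗ W) (V ⊗ W) inferInstance
    (@HasRightDual.mk _ _ _ _ (Wᘁ ⊗ Vᘁ) ExactPairing.tensor) (𝟙 _)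
  rw [MonoidalCategory.whiskerLeft_id, Category.id_comp] at this
  exact this

theorem coev_comp_rightDualTensorIso_hom (V W : C) :
    η_ (V ⊗ W) ((V ⊗ W)ᘁ) ≫ (V ⊗ W) ◁ (rightDualTensorIso V W).hom =
      η_ (V ⊗ W) (Wᘁ ⊗ Vᘁ) := by
  have := @coevaluation_comp_rightAdjointMate C _ _ (V ⊗ W) (V ⊗ W)
    (@HasRightDual.mk _ _ _ _ (Wᘁ ⊗ Vᘁ) ExactPairing.tensor) inferInstance (𝟙 _)
  rw [MonoidalCategory.id_whiskerRight, Category.comp_id] at this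
  exact this

variable [PivotalCategory C]

/-- The pivotal structure makes `V` a right dual of `Vᘁ`. -/
@[reducible]
def pivotalPairing (V : C) : ExactPairing (Vᘁ) V :=
  exactPairingCongrRight (PivotalCategory.j V)

/-- The coevaluation `𝟙 ⟶ Vᘁ ⊗ V` of the pivotal structure. -/
def coevL (V : C) : 𝟙_ C ⟶ Vᘁ ⊗ V :=
  η_ (Vᘁ) ((Vᘁ)ᘁ) ≫ Vᘁ ◁ (PivotalCategory.j V).inv

/-- The evaluation `V ⊗ Vᘁ ⟶ 𝟙` of the pivotal structure. -/
def evR (V : C) : V ⊗ Vᘁ ⟶ 𝟙_ C :=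
  (PivotalCategory.j V).hom ▷ Vᘁ ≫ ε_ (Vᘁ) ((Vᘁ)ᘁ)

theorem evR_coevL (V : C) :
    coevL V ▷ Vᘁ ≫ (α_ (Vᘁ) V (Vᘁ)).hom ≫ Vᘁ ◁ evR V = (λ_ (Vᘁ)).hom ≫ (ρ_ (Vᘁ)).inv :=
  (pivotalPairing V).evaluation_coevaluation'

/-- The pivotal coevaluation is dinatural, by naturality of the pivotal structure. -/
theorem coevL_naturality {V W : C} (f : V ⟶ W) :
    coevL V ≫ Vᘁ ◁ f = coevL W ≫ fᘁ ▷ W := by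
  have h : (PivotalCategory.j V).inv ≫ f = (fᘁ)ᘁ ≫ (PivotalCategory.j W).inv := by
    rw [Iso.inv_comp_eq, ← Category.assoc, ← PivotalCategory.j_naturality]
    simp
  rw [coevL, coevL, Category.assoc, ← MonoidalCategory.whiskerLeft_comp, h,
    MonoidalCategory.whiskerLeft_comp, ← Category.assoc,
    coevaluation_comp_rightAdjointMate, Category.assoc, Category.assoc, ← whisker_exchange]

/-- The left partial trace `A ⟶ B` of a morphism `V ⊗ A ⟶ V ⊗ B`. -/
def trL (V : C) {A B : C} (f : V ⊗ A ⟶ V ⊗ B) : A ⟶ B :=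
  (λ_ A).inv ≫ coevL V ▷ A ≫ (α_ (Vᘁ) V A).hom ≫ Vᘁ ◁ f ≫ (α_ (Vᘁ) V B).inv ≫
    ε_ V (Vᘁ) ▷ B ≫ (λ_ B).hom

theorem trL_whiskerLeft_comp (V : C) {A A' B : C} (a : A ⟶ A') (f : V ⊗ A' ⟶ V ⊗ B) :
    trL V (V ◁ a ≫ f) = a ≫ trL V f := by
  have h : coevL V ▷ A ≫ (Vᘁ ⊗ V) ◁ a = 𝟙_ C ◁ a ≫ coevL V ▷ A' := (whisker_exchange _ _).symm
  calc _ = 𝟙 _ ⊗≫ (coevL V ▷ A ≫ (Vᘁ ⊗ V) ◁ a) ⊗≫ Vᘁ ◁ f ⊗≫ ε_ V (Vᘁ) ▷ B ⊗≫ 𝟙 _ := by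
        rw [trL]; monoidal
    _ = _ := by rw [h, trL]; monoidal

theorem trL_comp_whiskerLeft (V : C) {A B B' : C} (f : V ⊗ A ⟶ V ⊗ B) (b : B ⟶ B') :
    trL V (f ≫ V ◁ b) = trL V f ≫ b := by
  have h : (Vᘁ ⊗ V) ◁ b ≫ ε_ V (Vᘁ) ▷ B' = ε_ V (Vᘁ) ▷ B ≫ 𝟙_ C ◁ b := whisker_exchange _ _
  calc _ = 𝟙 _ ⊗≫ coevL V ▷ A ⊗≫ Vᘁ ◁ f ⊗≫ ((Vᘁ ⊗ V) ◁ b ≫ ε_ V (Vᘁ) ▷ B') ⊗≫ 𝟙 _ := by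
        rw [trL]; monoidal
    _ = _ := by rw [h, trL]; monoidal

theorem trL_whiskerRight (V : C) {A B : C} (f : V ⊗ A ⟶ V ⊗ B) (D : C) :
    trL V ((α_ V A D).inv ≫ f ▷ D ≫ (α_ V B D).hom) = trL V f ▷ D := by
  rw [trL, trL]; monoidal

/-- Sliding a morphism around the closed strand. -/
theorem trL_slide {V W A B : C} (h : V ⟶ W) (f : W ⊗ A ⟶ V ⊗ B) :
    trL V (h ▷ A ≫ f) = trL W (f ≫ h ▷ B) := by
  -- both sides are brought to the form in which the dual of `h` acts on the closing strand
  calc _ = 𝟙 _ ⊗≫ (coevL V ≫ (Vᘁ : C) ◁ h) ▷ A ⊗≫ (Vᘁ : C) ◁ f ⊗≫ ε_ V (Vᘁ) ▷ B ⊗≫ 𝟙 _ := by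
        rw [trL]; monoidal
    _ = 𝟙 _ ⊗≫ coevL W ▷ A ⊗≫ (rightAdjointMate h ▷ (W ⊗ A) ≫ (Vᘁ : C) ◁ f) ⊗≫
        ε_ V (Vᘁ) ▷ B ⊗≫ 𝟙 _ := by
        rw [coevL_naturality]; monoidal
    _ = 𝟙 _ ⊗≫ coevL W ▷ A ⊗≫ (Wᘁ : C) ◁ f ⊗≫
        (rightAdjointMate h ▷ V ≫ ε_ V (Vᘁ)) ▷ B ⊗≫ 𝟙 _ := by
        rw [← whisker_exchange]; monoidal
    _ = _ := by rw [rightAdjointMate_comp_evaluation, trL]; monoidal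

theorem j_tensor_inv (V W : C) : (PivotalCategory.j (V ⊗ W)).inv =
    bidualTensor V W ≫ ((PivotalCategory.j V).inv ⊗ₘ (PivotalCategory.j W).inv) := by
  rw [← cancel_epi (PivotalCategory.j (V ⊗ W)).hom, Iso.hom_inv_id, ← Category.assoc,
    PivotalCategory.j_tensor]
  simp

/-- The pivotal coevaluation of `V ⊗ W` is nested; this is the monoidality of the pivotal
structure. -/
theorem coevL_tensor (V W : C) :
    coevL (V ⊗ W) = coevL W ⊗≫ Wᘁ ◁ coevL V ▷ W ⊗≫
      (rightDualTensorIso V W).inv ▷ (V ⊗ W) := by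
  calc _ = η_ (Wᘁ ⊗ Vᘁ) ((Wᘁ ⊗ Vᘁ)ᘁ) ≫ ((rightDualTensorIso V W).inv ▷ ((Wᘁ ⊗ Vᘁ)ᘁ) ≫
        ((V ⊗ W)ᘁ) ◁ ((rightDualTensorIso (Wᘁ) (Vᘁ)).hom ≫
          ((PivotalCategory.j V).inv ⊗ₘ (PivotalCategory.j W).inv))) := by
        rw [coevL, j_tensor_inv, bidualTensor, Category.assoc, MonoidalCategory.whiskerLeft_comp,
          coevaluation_comp_rightAdjointMate_assoc]
    _ = (η_ (Wᘁ ⊗ Vᘁ) ((Wᘁ ⊗ Vᘁ)ᘁ) ≫ (Wᘁ ⊗ Vᘁ) ◁ (rightDualTensorIso (Wᘁ) (Vᘁ)).hom) ≫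
        (Wᘁ ⊗ Vᘁ) ◁ ((PivotalCategory.j V).inv ⊗ₘ (PivotalCategory.j W).inv) ≫
        (rightDualTensorIso V W).inv ▷ (V ⊗ W) := by
        rw [← whisker_exchange]; simp
    _ = η_ (Wᘁ) ((Wᘁ)ᘁ) ⊗≫ (Wᘁ ◁ η_ (Vᘁ) ((Vᘁ)ᘁ) ⊗≫ Wᘁ ◁ Vᘁ ◁ (PivotalCategory.j V).inv) ▷ ((Wᘁ)ᘁ)
        ⊗≫ (Wᘁ ⊗ Vᘁ ⊗ V) ◁ (PivotalCategory.j W).inv ⊗≫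
        (rightDualTensorIso V W).inv ▷ (V ⊗ W) := by
        rw [coev_comp_rightDualTensorIso_hom, ExactPairing.tensor_coevaluation,
          MonoidalCategory.tensorHom_def]
        monoidal
    _ = η_ (Wᘁ) ((Wᘁ)ᘁ) ⊗≫ Wᘁ ◁ (coevL V ▷ ((Wᘁ)ᘁ) ≫ (Vᘁ ⊗ V) ◁ (PivotalCategory.j W).inv)
        ⊗≫ (rightDualTensorIso V W).inv ▷ (V ⊗ W) := by
        rw [coevL]; monoidal
    _ = _ := by rw [← whisker_exchange, coevL, coevL]; monoidal

/-- Tracing out `V ⊗ W` is tracing out `V`, then `W`. -/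
theorem trL_tensor (V W : C) {A B : C} (f : (V ⊗ W) ⊗ A ⟶ (V ⊗ W) ⊗ B) :
    trL (V ⊗ W) f = trL W (trL V ((α_ V W A).inv ≫ f ≫ (α_ V W B).hom)) := by
  calc _ = 𝟙 _ ⊗≫ coevL W ▷ A ⊗≫ Wᘁ ◁ coevL V ▷ (W ⊗ A) ⊗≫
        ((rightDualTensorIso V W).inv ▷ ((V ⊗ W) ⊗ A) ≫ (V ⊗ W)ᘁ ◁ f) ⊗≫
        ε_ (V ⊗ W) ((V ⊗ W)ᘁ) ▷ B ⊗≫ 𝟙 _ := by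
        rw [trL, coevL_tensor]; monoidal
    _ = 𝟙 _ ⊗≫ coevL W ▷ A ⊗≫ Wᘁ ◁ coevL V ▷ (W ⊗ A) ⊗≫ (Wᘁ ⊗ Vᘁ) ◁ f ⊗≫
        ((rightDualTensorIso V W).inv ▷ (V ⊗ W) ≫ ε_ (V ⊗ W) ((V ⊗ W)ᘁ)) ▷ B ⊗≫ 𝟙 _ := by
        rw [← whisker_exchange]; monoidal
    _ = _ := by
        rw [rightDualTensorIso_inv_comp_eval, ExactPairing.tensor_evaluation, trL, trL]; monoidal

theorem ptrL_eq {V : C} (f : V ⟶ V) : ptrL f = coevL V ≫ Vᘁ ◁ f ≫ ε_ V (Vᘁ) := by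
  simp [ptrL, coevL]

theorem ptrR_eq {V : C} (f : V ⟶ V) : ptrR f = η_ V (Vᘁ) ≫ f ▷ Vᘁ ≫ evR V := by
  simp [ptrR, evR]

theorem ptrL_comm {V W : C} (f : V ⟶ W) (g : W ⟶ V) : ptrL (f ≫ g) = ptrL (g ≫ f) := by
  rw [ptrL_eq, ptrL_eq, MonoidalCategory.whiskerLeft_comp, MonoidalCategory.whiskerLeft_comp,
    Category.assoc, Category.assoc, reassoc_of% coevL_naturality f, ← whisker_exchange_assoc,
    rightAdjointMate_comp_evaluation]

theorem ptrL_eq_trL {V : C} (f : V ⟶ V) : ptrL f = trL V ((ρ_ V).hom ≫ f ≫ (ρ_ V).inv) := by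
  rw [ptrL_eq, trL]; monoidal

theorem ptrL_tensor (V A : C) (f : V ⊗ A ⟶ V ⊗ A) : ptrL f = ptrL (trL V f) := by
  rw [ptrL_eq_trL, ptrL_eq_trL, trL_tensor, ← trL_comp_whiskerLeft, ← trL_whiskerLeft_comp]
  congr 2
  monoidal

theorem ptrL_conj {V W : C} (e : V ≅ W) (f : W ⟶ W) : ptrL (e.hom ≫ f ≫ e.inv) = ptrL f := by
  rw [ptrL_comm]; simp

variable [Preadditive C] [MonoidalPreadditive C]

theorem trL_add (V : C) {A B : C} (f g : V ⊗ A ⟶ V ⊗ B) : trL V (f + g) = trL V f + trL V g := by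
  simp only [trL, MonoidalPreadditive.whiskerLeft_add, Preadditive.add_comp, Preadditive.comp_add]

theorem ptrL_add {V : C} (f g : V ⟶ V) : ptrL (f + g) = ptrL f + ptrL g := by
  simp only [ptrL, MonoidalPreadditive.whiskerLeft_add, Preadditive.add_comp, Preadditive.comp_add]

variable [Linear ℂ C] [MonoidalLinear ℂ C]

theorem trL_smul (V : C) {A B : C} (c : ℂ) (f : V ⊗ A ⟶ V ⊗ B) : trL V (c • f) = c • trL V f := by
  simp only [trL, MonoidalLinear.whiskerLeft_smul, Linear.smul_comp, Linear.comp_smul]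

theorem ptrL_smul {V : C} (c : ℂ) (f : V ⟶ V) : ptrL (c • f) = c • ptrL f := by
  simp only [ptrL, MonoidalLinear.whiskerLeft_smul, Linear.smul_comp, Linear.comp_smul]

/-- The rotation exchanges the two coevaluations of `V`. -/
theorem rotate_coev (V : C) : rotate V (Vᘁ) (η_ V (Vᘁ)) = coevL V := by
  calc _ = coevL V ⊗≫ (Vᘁ ◁ η_ V (Vᘁ) ⊗≫ ε_ V (Vᘁ) ▷ Vᘁ) ▷ V ⊗≫ 𝟙 _ := by
        change η_ (Vᘁ) ((Vᘁ)ᘁ) ≫ _ = _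
        rw [coevL]; monoidal
    _ = _ := by rw [ExactPairing.coevaluation_evaluation'']; monoidal

end PartialTrace

/-! ### The twist of a braided pivotal category -/

section Braided

variable {C : Type u} [Category.{v} C] [MonoidalCategory C] [BraidedCategory C]

theorem monodromy_naturality_right (X : C) {A B : C} (f : A ⟶ B) :
    X ◁ f ≫ monodromy X B = monodromy X A ≫ X ◁ f := by
  simp [monodromy]

theorem monodromy_naturality_left {A B : C} (f : A ⟶ B) (X : C) :
    f ▷ X ≫ monodromy B X = monodromy A X ≫ f ▷ X := by
  simp [monodromy]

theorem monodromy_tensor_left (X Y A : C) : monodromy (X ⊗ Y) A =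
    (α_ X Y A).hom ≫ X ◁ (β_ Y A).hom ≫ (α_ X A Y).inv ≫ monodromy X A ▷ Y ≫
      (α_ X A Y).hom ≫ X ◁ (β_ A Y).hom ≫ (α_ X Y A).inv := by
  simp [monodromy]

/-- When `V` moves past `W` after `V ⊗ W` has wound around `X`, it may as well let `W` wind alone,
move past `W`, and wind once it is next to `X`. -/
theorem monodromy_comp_braiding (V W X : C) :
    monodromy (V ⊗ W) X ≫ (β_ V W).hom ▷ X =
      (α_ V W X).hom ≫ V ◁ monodromy W X ≫ (α_ V W X).inv ≫ (β_ V W).hom ▷ X ≫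
        (α_ W V X).hom ≫ W ◁ monodromy V X ≫ (α_ W V X).inv := by
  calc _ = ((β_ V W).hom ▷ X ⊗≫ W ◁ (β_ V X).hom ⊗≫ (β_ W X).hom ▷ V) ⊗≫
        (β_ X W).hom ▷ V ⊗≫ W ◁ (β_ X V).hom ⊗≫ 𝟙 _ := by
        rw [← monodromy_naturality_left, monodromy, BraidedCategory.braiding_tensor_left_hom,
          BraidedCategory.braiding_tensor_right_hom]
        monoidal
    _ = 𝟙 _ ⊗≫ V ◁ (β_ W X).hom ⊗≫ ((β_ V X).hom ▷ W ⊗≫ X ◁ (β_ V W).hom ⊗≫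
        (β_ X W).hom ▷ V) ⊗≫ W ◁ (β_ X V).hom ⊗≫ 𝟙 _ := by
        rw [BraidedCategory.yang_baxter' V W X]; monoidal
    _ = _ := by rw [BraidedCategory.yang_baxter' V X W, monodromy, monodromy]; monoidal

variable [RightRigidCategory C]

/-- The Drinfeld isomorphism compares the evaluation of `Vᘁ` with that of `V` through the
braiding. -/
theorem drinfeld_comp_eval (V : C) :
    drinfeld V ▷ Vᘁ ≫ ε_ (Vᘁ) ((Vᘁ)ᘁ) = (β_ V (Vᘁ)).hom ≫ ε_ V (Vᘁ) := by
  have := @rightAdjointMate_comp_evaluation C _ _ (Vᘁ) (Vᘁ) inferInstance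
    (@HasRightDual.mk _ _ _ _ V (BraidedCategory.exactPairing_swap V (Vᘁ))) (𝟙 _)
  rw [MonoidalCategory.whiskerLeft_id, Category.id_comp] at this
  rw [drinfeld_eq]
  exact this

variable [PivotalCategory C]

theorem twist_comp_braiding_comp_eval (V : C) :
    twist V ▷ Vᘁ ≫ (β_ V (Vᘁ)).hom ≫ ε_ V (Vᘁ) = evR V := by
  rw [← drinfeld_comp_eval, twist, evR]
  simp

/-- The left partial trace of the self-braiding of `V`. In the spherical case it acts on a simple
object by the same scalar as the twist. -/
def twistL (V : C) : V ⟶ V := trL V (β_ V V).hom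

theorem twistL_naturality {A B : C} (f : A ⟶ B) : f ≫ twistL B = twistL A ≫ f := by
  rw [twistL, twistL, ← trL_whiskerLeft_comp, ← trL_comp_whiskerLeft,
    BraidedCategory.braiding_naturality_right, ← BraidedCategory.braiding_naturality_left,
    trL_slide]

theorem twistL_unit : twistL (𝟙_ C) = ptrL (𝟙 (𝟙_ C)) := by
  rw [twistL, ptrL_eq_trL, braiding_tensorUnit_left]
  congr 1
  monoidal

/-- Balancing. -/
theorem twistL_tensor (V W : C) :
    twistL (V ⊗ W) = (twistL V ⊗ₘ twistL W) ≫ monodromy V W := by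
  -- the only crossing of the outer closed strand `V` is its self-crossing
  have h1 : (α_ V W (V ⊗ W)).inv ≫ (β_ (V ⊗ W) (V ⊗ W)).hom ≫ (α_ V W (V ⊗ W)).hom =
      V ◁ ((α_ W V W).inv ≫ (β_ W V).hom ▷ W ≫ (α_ V W W).hom ≫ V ◁ (β_ W W).hom) ≫
      ((α_ V V (W ⊗ W)).inv ≫ (β_ V V).hom ▷ (W ⊗ W) ≫ (α_ V V (W ⊗ W)).hom) ≫
      V ◁ ((α_ V W W).inv ≫ (β_ V W).hom ▷ W ≫ (α_ W V W).hom) := by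
    rw [BraidedCategory.braiding_tensor_left_hom, BraidedCategory.braiding_tensor_right_hom,
      BraidedCategory.braiding_tensor_right_hom]
    monoidal
  -- after closing `V`, Yang-Baxter isolates the self-crossing of `W`
  have h2 : ((α_ W V W).inv ≫ (β_ W V).hom ▷ W ≫ (α_ V W W).hom ≫ V ◁ (β_ W W).hom) ≫
      twistL V ▷ (W ⊗ W) ≫ (α_ V W W).inv ≫ (β_ V W).hom ▷ W ≫ (α_ W V W).hom =
      W ◁ (twistL V ▷ W ≫ (β_ V W).hom) ≫
      ((α_ W W V).inv ≫ (β_ W W).hom ▷ V ≫ (α_ W W V).hom) ≫ W ◁ (β_ W V).hom := by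
    calc _ = 𝟙 _ ⊗≫ (β_ W V).hom ▷ W ⊗≫ (V ◁ (β_ W W).hom ≫ twistL V ▷ (W ⊗ W)) ⊗≫
          (β_ V W).hom ▷ W ⊗≫ 𝟙 _ := by monoidal
      _ = 𝟙 _ ⊗≫ ((β_ W V).hom ≫ twistL V ▷ W) ▷ W ⊗≫ V ◁ (β_ W W).hom ⊗≫
          (β_ V W).hom ▷ W ⊗≫ 𝟙 _ := by rw [whisker_exchange]; monoidal
      _ = 𝟙 _ ⊗≫ W ◁ twistL V ▷ W ⊗≫ ((β_ W V).hom ▷ W ⊗≫ V ◁ (β_ W W).hom ⊗≫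
          (β_ V W).hom ▷ W) ⊗≫ 𝟙 _ := by
          rw [← BraidedCategory.braiding_naturality_right]; monoidal
      _ = _ := by rw [BraidedCategory.yang_baxter' W V W]; monoidal
  rw [twistL, trL_tensor, h1, trL_whiskerLeft_comp, trL_comp_whiskerLeft, trL_whiskerRight]
  change trL W (_ ≫ twistL V ▷ _ ≫ _) = _
  rw [h2, trL_whiskerLeft_comp, trL_comp_whiskerLeft, trL_whiskerRight, monodromy,
    MonoidalCategory.tensorHom_def, Category.assoc, Category.assoc,
    BraidedCategory.braiding_naturality_right_assoc]
  rfl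

/-- In a braided pivotal category the rotation is a braiding composed with a twist. -/
theorem rotate_eq [Preadditive C] [Linear ℂ C] [MonoidalPreadditive C] [MonoidalLinear ℂ C]
    (V W : C) (f : 𝟙_ C ⟶ V ⊗ W) :
    rotate V W f = f ≫ twistL V ▷ W ≫ (β_ V W).hom := by
  have h : (λ_ V).inv ≫ f ▷ V = (ρ_ V).inv ≫ V ◁ f ≫ (β_ V (V ⊗ W)).hom := by
    rw [BraidedCategory.braiding_naturality_right]; simp
  calc rotate V W f = coevL V ⊗≫ Vᘁ ◁ ((λ_ V).inv ≫ f ▷ V) ⊗≫ ε_ V (Vᘁ) ▷ (W ⊗ V) ⊗≫ 𝟙 _ := by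
        change η_ (Vᘁ) ((Vᘁ)ᘁ) ≫ _ = _
        rw [coevL]; monoidal
    _ = 𝟙 _ ⊗≫ (coevL V ▷ 𝟙_ C ≫ (Vᘁ ⊗ V) ◁ f) ⊗≫ Vᘁ ◁ (β_ V (V ⊗ W)).hom ⊗≫
        ε_ V (Vᘁ) ▷ (W ⊗ V) ⊗≫ 𝟙 _ := by
        rw [h]; monoidal
    _ = f ⊗≫ coevL V ▷ (V ⊗ W) ⊗≫ Vᘁ ◁ (β_ V V).hom ▷ W ⊗≫ ((Vᘁ ⊗ V) ◁ (β_ V W).hom ≫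
        ε_ V (Vᘁ) ▷ (W ⊗ V)) ⊗≫ 𝟙 _ := by
        rw [← whisker_exchange, BraidedCategory.braiding_tensor_right_hom]; monoidal
    _ = _ := by rw [whisker_exchange, twistL, trL]; monoidal

/-- The two evaluations of `V` differ by the inverse braiding and the left trace of the
self-braiding; no sphericality is used. -/
theorem twistL_comp_evR (V : C) :
    twistL V ▷ Vᘁ ≫ evR V = (β_ (Vᘁ) V).inv ≫ ε_ V (Vᘁ) := by
  -- a strand that crosses one leg of the evaluation crosses the other leg inversely
  have h : (β_ V V).hom ▷ Vᘁ ⊗≫ V ◁ evR V =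
      𝟙 _ ⊗≫ V ◁ (β_ (Vᘁ) V).inv ⊗≫ evR V ▷ V ⊗≫ 𝟙 _ := by
    have h' := BraidedCategory.braiding_naturality_left (evR V) V
    rw [BraidedCategory.braiding_tensor_left_hom, braiding_tensorUnit_left] at h'
    calc _ = 𝟙 _ ⊗≫ V ◁ ((β_ (Vᘁ) V).inv ≫ (β_ (Vᘁ) V).hom) ⊗≫ (β_ V V).hom ▷ Vᘁ ⊗≫
          V ◁ evR V := by rw [Iso.inv_hom_id]; monoidal
      _ = 𝟙 _ ⊗≫ V ◁ (β_ (Vᘁ) V).inv ⊗≫ (((α_ V (Vᘁ) V).hom ≫ V ◁ (β_ (Vᘁ) V).hom ≫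
          (α_ V V (Vᘁ)).inv ≫ (β_ V V).hom ▷ Vᘁ ≫ (α_ V V (Vᘁ)).hom) ≫ V ◁ evR V) := by
          monoidal
      _ = _ := by rw [← h']; monoidal
  have hs : coevL V ▷ Vᘁ ⊗≫ Vᘁ ◁ evR V = ⊗𝟙.hom := by
    have := evR_coevL V
    calc _ = coevL V ▷ Vᘁ ≫ (α_ (Vᘁ) V (Vᘁ)).hom ≫ Vᘁ ◁ evR V := by monoidal
      _ = _ := by rw [this]; monoidal
  calc _ = 𝟙 _ ⊗≫ coevL V ▷ (V ⊗ Vᘁ) ⊗≫ Vᘁ ◁ (β_ V V).hom ▷ Vᘁ ⊗≫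
        (ε_ V (Vᘁ) ▷ (V ⊗ Vᘁ) ≫ 𝟙_ C ◁ evR V) ⊗≫ 𝟙 _ := by
        rw [twistL, trL]; monoidal
    _ = 𝟙 _ ⊗≫ coevL V ▷ (V ⊗ Vᘁ) ⊗≫ Vᘁ ◁ ((β_ V V).hom ▷ Vᘁ ⊗≫ V ◁ evR V) ⊗≫
        ε_ V (Vᘁ) ⊗≫ 𝟙 _ := by rw [← whisker_exchange]; monoidal
    _ = 𝟙 _ ⊗≫ (coevL V ▷ (V ⊗ Vᘁ) ≫ (Vᘁ ⊗ V) ◁ (β_ (Vᘁ) V).inv) ⊗≫ Vᘁ ◁ evR V ▷ V ⊗≫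
        ε_ V (Vᘁ) := by rw [h]; monoidal
    _ = 𝟙 _ ⊗≫ (β_ (Vᘁ : C) V).inv ⊗≫ (coevL V ▷ Vᘁ ⊗≫ (Vᘁ : C) ◁ evR V) ▷ V ⊗≫ ε_ V (Vᘁ) := by
        rw [← whisker_exchange]; monoidal
    _ = _ := by rw [hs]; monoidal

end Braided

/-! ### Closing the braid that rotates tensor factors -/

section Closure

variable {C : Type u} [Category.{v} C] [MonoidalCategory C] [BraidedCategory C]

/-- On `(V ⊗ W) ⊗ X`: the braiding of `V` past `W`, then an endomorphism `t` of `V ⊗ X`, then a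
morphism `s : W ⊗ V ⟶ V ⊗ W`. For `W = V^{⊗ n}` and `s` the rebracketing, `V` moves from the first
to the last place. -/
def shiftBraid {V W : C} (s : W ⊗ V ⟶ V ⊗ W) {X : C} (t : V ⊗ X ⟶ V ⊗ X) :
    (V ⊗ W) ⊗ X ⟶ (V ⊗ W) ⊗ X :=
  (β_ V W).hom ▷ X ≫ (α_ W V X).hom ≫ W ◁ t ≫ (α_ W V X).inv ≫ s ▷ X

theorem monodromy_comp_shiftBraid {V W : C} (s : W ⊗ V ⟶ V ⊗ W) {X : C} (t : V ⊗ X ⟶ V ⊗ X) :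
    (α_ V (V ⊗ W) X).inv ≫ (monodromy (V ⊗ V ⊗ W) X ≫
        shiftBraid ((α_ V W V).hom ≫ V ◁ s) t) ≫ (α_ V (V ⊗ W) X).hom =
      V ◁ (monodromy (V ⊗ W) X ≫ (α_ V W X).hom) ≫
      ((α_ V V (W ⊗ X)).inv ≫ (β_ V V).hom ▷ (W ⊗ X) ≫ (α_ V V (W ⊗ X)).hom) ≫
      V ◁ ((α_ V W X).inv ≫ shiftBraid s (monodromy V X ≫ t)) := by
  have h : ∀ (m : (V ⊗ W) ⊗ X ⟶ (V ⊗ W) ⊗ X) (m' : V ⊗ X ⟶ V ⊗ X),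
      (α_ V (V ⊗ W) X).inv ≫ (((α_ V (V ⊗ W) X).hom ≫ V ◁ m ≫ (α_ V (V ⊗ W) X).inv ≫
        (β_ V (V ⊗ W)).hom ▷ X ≫ (α_ (V ⊗ W) V X).hom ≫ (V ⊗ W) ◁ m' ≫
          (α_ (V ⊗ W) V X).inv) ≫ (α_ (V ⊗ W) V X).hom ≫ (V ⊗ W) ◁ t ≫
            (α_ (V ⊗ W) V X).inv ≫ ((α_ V W V).hom ≫ V ◁ s) ▷ X) ≫ (α_ V (V ⊗ W) X).hom =
      V ◁ (m ≫ (α_ V W X).hom) ≫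
      ((α_ V V (W ⊗ X)).inv ≫ (β_ V V).hom ▷ (W ⊗ X) ≫ (α_ V V (W ⊗ X)).hom) ≫
      V ◁ ((α_ V W X).inv ≫ shiftBraid s (m' ≫ t)) := by
    intro m m'
    rw [shiftBraid, BraidedCategory.braiding_tensor_right_hom]
    monoidal
  rw [shiftBraid, ← Category.assoc (monodromy _ _), monodromy_comp_braiding]
  exact h _ _

variable [RightRigidCategory C] [PivotalCategory C]

/-- Closing the first strand removes one factor from the rotating braid, turns its crossing into a
twist, and adds one winding of the last factor around `X`. -/
theorem trL_monodromy_comp_shiftBraid {V W : C} (s : W ⊗ V ⟶ V ⊗ W) {X : C}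
    (t : V ⊗ X ⟶ V ⊗ X) :
    trL V ((α_ V (V ⊗ W) X).inv ≫ (monodromy (V ⊗ V ⊗ W) X ≫
        shiftBraid ((α_ V W V).hom ≫ V ◁ s) t) ≫ (α_ V (V ⊗ W) X).hom) =
      monodromy (V ⊗ W) X ≫ (twistL V ▷ W) ▷ X ≫ shiftBraid s (monodromy V X ≫ t) := by
  rw [monodromy_comp_shiftBraid, trL_whiskerLeft_comp, trL_comp_whiskerLeft, trL_whiskerRight]
  change (_ ≫ _) ≫ twistL V ▷ _ ≫ _ = _
  simp

theorem ptrL_monodromy_comp_shiftBraid_unit (V X : C) (t : V ⊗ X ⟶ V ⊗ X) :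
    ptrL (monodromy (V ⊗ 𝟙_ C) X ≫ shiftBraid ((λ_ V).hom ≫ (ρ_ V).inv) t) =
      ptrL (monodromy V X ≫ t) := by
  have h : shiftBraid ((λ_ V).hom ≫ (ρ_ V).inv) t = (ρ_ V).hom ▷ X ≫ t ≫ (ρ_ V).inv ▷ X := by
    rw [shiftBraid, braiding_tensorUnit_right]
    monoidal
  have h2 : (ρ_ V).inv ▷ X ≫ monodromy (V ⊗ 𝟙_ C) X = monodromy V X ≫ (ρ_ V).inv ▷ X :=
    monodromy_naturality_left _ _
  calc _ = ptrL ((monodromy (V ⊗ 𝟙_ C) X ≫ (ρ_ V).hom ▷ X ≫ t) ≫ (ρ_ V).inv ▷ X) := by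
        rw [h]; simp only [Category.assoc]
    _ = ptrL (((ρ_ V).inv ▷ X ≫ monodromy (V ⊗ 𝟙_ C) X) ≫ (ρ_ V).hom ▷ X ≫ t) := by
        rw [ptrL_comm]; simp only [Category.assoc]
    _ = _ := by rw [h2]; simp

variable [Preadditive C] [Linear ℂ C] [MonoidalPreadditive C] [MonoidalLinear ℂ C]

/-- The closure of the rotation of `n + 1` factors `V`, encircled by `X`, is a single strand `V`
winding `n + 1` times around `X`, up to `n` twists. -/
theorem ptrL_rotation_closure (V X : C) {τ : ℂ} (hτ : twistL V = τ • 𝟙 V) (n : ℕ) :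
    ptrL (monodromy (V ⊗ tpow V n) X ≫ ((β_ V (tpow V n)).hom ≫ (tpowShift V n).hom) ▷ X) =
      τ ^ n • ptrL (monodromy V X ^ (n + 1) : End (V ⊗ X)) := by
  have key : ∀ (n : ℕ) (t : V ⊗ X ⟶ V ⊗ X),
      ptrL (monodromy (V ⊗ tpow V n) X ≫ shiftBraid (tpowShift V n).hom t) =
        τ ^ n • ptrL ((monodromy V X ^ (n + 1) : End (V ⊗ X)) ≫ t) := by
    intro n
    induction n with
    | zero =>
      intro t
      rw [pow_zero, one_smul, zero_add, pow_one]
      exact ptrL_monodromy_comp_shiftBraid_unit V X t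
    | succ n ih =>
      intro t
      have h1 : ptrL (monodromy (V ⊗ tpow V (n + 1)) X ≫ shiftBraid (tpowShift V (n + 1)).hom t) =
          ptrL (trL V ((α_ V (V ⊗ tpow V n) X).inv ≫ (monodromy (V ⊗ V ⊗ tpow V n) X ≫
            shiftBraid ((α_ V (tpow V n) V).hom ≫ V ◁ (tpowShift V n).hom) t) ≫
              (α_ V (V ⊗ tpow V n) X).hom)) := by
        rw [← ptrL_tensor]
        exact (ptrL_conj (α_ V (V ⊗ tpow V n) X).symm _).symm
      have h2 : monodromy (V ⊗ tpow V n) X ≫ (twistL V ▷ tpow V n) ▷ X ≫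
            shiftBraid (tpowShift V n).hom (monodromy V X ≫ t) =
          τ • (monodromy (V ⊗ tpow V n) X ≫
            shiftBraid (tpowShift V n).hom (monodromy V X ≫ t)) := by
        rw [hτ]
        simp [MonoidalLinear.smul_whiskerRight]
      have h3 : (monodromy V X ^ (n + 1) : End (V ⊗ X)) ≫ monodromy V X ≫ t =
          (monodromy V X ^ (n + 1 + 1) : End (V ⊗ X)) ≫ t := by
        rw [pow_succ' _ (n + 1), End.mul_def, Category.assoc]
      rw [h1, trL_monodromy_comp_shiftBraid, h2, ptrL_smul, ih, h3, smul_smul, ← pow_succ']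
  have h0 : shiftBraid (tpowShift V n).hom (𝟙 (V ⊗ X)) =
      ((β_ V (tpow V n)).hom ≫ (tpowShift V n).hom) ▷ X := by
    simp [shiftBraid]
  rw [← h0, key, Category.comp_id]

end Closure

/-! ### Trace functionals on a fusion category -/

section Functionals

variable (C : Type u) [Category.{v} C] [Preadditive C] [Linear ℂ C]

/-- A family of linear functionals on the endomorphism spaces of a category that is cyclic, i.e.
vanishes on all `f ≫ g - g ≫ f`. -/
structure TraceFunctional where
  /-- The functional on `End A`. -/
  toFun : ∀ A : C, (A ⟶ A) →ₗ[ℂ] ℂ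
  comm : ∀ {A B : C} (f : A ⟶ B) (g : B ⟶ A), toFun A (f ≫ g) = toFun B (g ≫ f)

variable {C}

theorem endScalar_add {V : C} (f g : V ⟶ V) : endScalar (f + g) = endScalar f + endScalar g := by
  rw [endScalar, endScalar, endScalar, ← map_add]
  congr 1
  ext h
  simp

theorem endScalar_smul {V : C} (c : ℂ) (f : V ⟶ V) : endScalar (c • f) = c * endScalar f := by
  rw [endScalar, endScalar, ← smul_eq_mul, ← map_smul]
  congr 1
  ext h
  simp

theorem endScalar_id {V : C} (h : Module.finrank ℂ (V ⟶ V) = 1) : endScalar (𝟙 V) = 1 := by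
  have h' : Linear.rightComp ℂ V (𝟙 V) = LinearMap.id := by ext; simp
  have : FiniteDimensional ℂ (V ⟶ V) := Module.finite_of_finrank_eq_succ h
  rw [endScalar, h', LinearMap.trace_id, h, Nat.cast_one]

theorem TraceFunctional.iso_eq (F : TraceFunctional C) {A B : C} (e : A ≅ B) :
    F.toFun A (𝟙 A) = F.toFun B (𝟙 B) := by
  rw [← e.hom_inv_id, F.comm, e.inv_hom_id]

theorem TraceFunctional.eq_endScalar_mul (F : TraceFunctional C) {V : C}
    (h : Module.finrank ℂ (V ⟶ V) = 1) (f : V ⟶ V) :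
    F.toFun V f = endScalar f * F.toFun V (𝟙 V) := by
  conv_lhs => rw [eq_endScalar_smul h f, map_smul, smul_eq_mul]

/-- The trace of composition on the spaces `Hom(Y, A)`. -/
def homTrace (Y : C) [∀ A : C, FiniteDimensional ℂ (Y ⟶ A)] : TraceFunctional C where
  toFun A :=
    { toFun f := LinearMap.trace ℂ (Y ⟶ A) (Linear.rightComp ℂ Y f)
      map_add' f g := by
        rw [← map_add]; congr 1; ext; simp
      map_smul' c f := by
        rw [RingHom.id_apply, ← map_smul]; congr 1; ext; simp }
  comm {A B} f g := by
    have h1 : Linear.rightComp ℂ Y (f ≫ g) = Linear.rightComp ℂ Y g ∘ₗ Linear.rightComp ℂ Y f := by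
      ext; simp
    have h2 : Linear.rightComp ℂ Y (g ≫ f) = Linear.rightComp ℂ Y f ∘ₗ Linear.rightComp ℂ Y g := by
      ext; simp
    change LinearMap.trace ℂ (Y ⟶ A) _ = LinearMap.trace ℂ (Y ⟶ B) _
    rw [h1, h2, LinearMap.trace_comp_comm']

theorem homTrace_id (Y A : C) [∀ A : C, FiniteDimensional ℂ (Y ⟶ A)] :
    (homTrace Y).toFun A (𝟙 A) = Module.finrank ℂ (Y ⟶ A) := by
  have : Linear.rightComp ℂ Y (𝟙 A) = LinearMap.id := by ext; simp
  change LinearMap.trace ℂ (Y ⟶ A) _ = _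
  rw [this, LinearMap.trace_id]

/-- The trace of composition on the spaces `Hom(A, Y)`. -/
def cohomTrace (Y : C) [∀ A : C, FiniteDimensional ℂ (A ⟶ Y)] : TraceFunctional C where
  toFun A :=
    { toFun f := LinearMap.trace ℂ (A ⟶ Y) (Linear.leftComp ℂ Y f)
      map_add' f g := by
        rw [← map_add]; congr 1; ext; simp
      map_smul' c f := by
        rw [RingHom.id_apply, ← map_smul]; congr 1; ext; simp }
  comm {A B} f g := by
    have h1 : Linear.leftComp ℂ Y (f ≫ g) = Linear.leftComp ℂ Y f ∘ₗ Linear.leftComp ℂ Y g := by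
      ext; simp
    have h2 : Linear.leftComp ℂ Y (g ≫ f) = Linear.leftComp ℂ Y g ∘ₗ Linear.leftComp ℂ Y f := by
      ext; simp
    change LinearMap.trace ℂ (A ⟶ Y) _ = LinearMap.trace ℂ (B ⟶ Y) _
    rw [h1, h2, LinearMap.trace_comp_comm']

theorem cohomTrace_id (Y A : C) [∀ A : C, FiniteDimensional ℂ (A ⟶ Y)] :
    (cohomTrace Y).toFun A (𝟙 A) = Module.finrank ℂ (A ⟶ Y) := by
  have : Linear.leftComp ℂ Y (𝟙 A) = LinearMap.id := by ext; simp
  change LinearMap.trace ℂ (A ⟶ Y) _ = _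
  rw [this, LinearMap.trace_id]

end Functionals

section Fusion

variable {C : Type u} [Category.{v} C] [Abelian C] [Linear ℂ C] [MonoidalCategory C]
  [MonoidalPreadditive C] [MonoidalLinear ℂ C] [RightRigidCategory C] [FusionCategory C]

attribute [local instance] Abelian.hasFiniteBiproducts

instance finiteDimensional_hom (V W : C) : FiniteDimensional ℂ (V ⟶ W) :=
  FusionCategory.finite_hom V W

theorem exists_simple_decomposition (A : C) : ∃ (m : ℕ) (S : Fin m → C) (p : ∀ a, A ⟶ S a)
    (i : ∀ a, S a ⟶ A), (∀ a, Simple (S a)) ∧ ∑ a, p a ≫ i a = 𝟙 A := by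
  obtain ⟨m, S, hS, ⟨e⟩⟩ := FusionCategory.semisimple A
  refine ⟨m, S, fun a => e.hom ≫ biproduct.π S a, fun a => biproduct.ι S a ≫ e.inv, hS, ?_⟩
  have := biproduct.total (f := S)
  calc _ = e.hom ≫ (∑ a, biproduct.π S a ≫ biproduct.ι S a) ≫ e.inv := by
        simp only [Preadditive.comp_sum, Preadditive.sum_comp, Category.assoc]
    _ = _ := by rw [this]; simp

variable {Γ : Type w} {X : Γ → C}

theorem finrank_simple_hom [DecidableEq Γ] (hX : IsCompleteSimples X) (i k : Γ) :
    Module.finrank ℂ (X i ⟶ X k) = if i = k then 1 else 0 := by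
  have := hX.simple i
  have := hX.simple k
  split_ifs with h
  · subst h
    exact FusionCategory.finrank_end _ (hX.simple i)
  · exact finrank_hom_simple_simple_eq_zero_of_not_iso ℂ fun e => h (hX.eq_of_iso i k ⟨e⟩)

/-- A trace functional is determined by its values at the identities of the simple objects. -/
theorem TraceFunctional.eq_sum [Fintype Γ] [DecidableEq Γ] (hX : IsCompleteSimples X)
    (G : Γ → TraceFunctional C)
    (hG : ∀ i k, (G i).toFun (X k) (𝟙 (X k)) = if i = k then 1 else 0)
    (F : TraceFunctional C) {A : C} (f : A ⟶ A) :
    F.toFun A f = ∑ i, (G i).toFun A f * F.toFun (X i) (𝟙 (X i)) := by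
  obtain ⟨m, S, p, q, hS, hpq⟩ := exists_simple_decomposition A
  have hF : ∀ F : TraceFunctional C,
      F.toFun A f = ∑ a, endScalar (q a ≫ f ≫ p a) * F.toFun (S a) (𝟙 (S a)) := by
    intro F
    calc F.toFun A f = F.toFun A (f ≫ ∑ a, p a ≫ q a) := by rw [hpq, Category.comp_id]
      _ = ∑ a, F.toFun A ((f ≫ p a) ≫ q a) := by
          rw [Preadditive.comp_sum, map_sum]; simp only [Category.assoc]
      _ = _ := by
          refine Finset.sum_congr rfl fun a _ => ?_
          rw [F.comm, F.eq_endScalar_mul (FusionCategory.finrank_end _ (hS a))]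
  rw [hF F]
  simp_rw [hF (G _), Finset.sum_mul]
  rw [Finset.sum_comm]
  refine Finset.sum_congr rfl fun a _ => ?_
  obtain ⟨i, ⟨e⟩⟩ := hX.exists_iso (S a) (hS a)
  simp [TraceFunctional.iso_eq _ e, hG]

theorem TraceFunctional.eq_sum_homTrace [Fintype Γ] (hX : IsCompleteSimples X)
    (F : TraceFunctional C) {A : C} (f : A ⟶ A) :
    F.toFun A f = ∑ i, (homTrace (X i)).toFun A f * F.toFun (X i) (𝟙 (X i)) := by
  classical
  refine F.eq_sum hX (fun i => homTrace (X i)) (fun i k => ?_) f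
  rw [homTrace_id, finrank_simple_hom hX]
  split_ifs <;> simp

theorem TraceFunctional.id_eq_sum [Fintype Γ] (hX : IsCompleteSimples X)
    (F : TraceFunctional C) (A : C) :
    F.toFun A (𝟙 A) = ∑ i, (Module.finrank ℂ (X i ⟶ A) : ℂ) * F.toFun (X i) (𝟙 (X i)) := by
  rw [F.eq_sum_homTrace hX]
  simp_rw [homTrace_id]

theorem TraceFunctional.id_eq_sum_co [Fintype Γ] (hX : IsCompleteSimples X)
    (F : TraceFunctional C) (A : C) :
    F.toFun A (𝟙 A) = ∑ i, (Module.finrank ℂ (A ⟶ X i) : ℂ) * F.toFun (X i) (𝟙 (X i)) := by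
  classical
  rw [F.eq_sum hX (fun i => cohomTrace (X i)) (fun i k => ?_)]
  · simp_rw [cohomTrace_id]
  · rw [cohomTrace_id, finrank_simple_hom hX]
    simp [eq_comm]

end Fusion

/-! ### Duals and adjunctions in a fusion category -/

theorem finrank_hom_congr {C : Type u} [Category.{v} C] [Preadditive C] [Linear ℂ C]
    {A A' B B' : C} (e : A ≅ A') (e' : B ≅ B') :
    Module.finrank ℂ (A ⟶ B) = Module.finrank ℂ (A' ⟶ B') :=
  (Linear.homCongr ℂ e e').finrank_eq

section Duals

variable {C : Type u} [Category.{v} C] [MonoidalCategory C]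

section

variable [Preadditive C] [Linear ℂ C] [MonoidalPreadditive C] [MonoidalLinear ℂ C]

theorem finrank_tensorRight (A Y Y' B : C) [ExactPairing Y Y'] :
    Module.finrank ℂ (A ⊗ Y ⟶ B) = Module.finrank ℂ (A ⟶ B ⊗ Y') :=
  LinearEquiv.finrank_eq
    { tensorRightHomEquiv A Y Y' B with
      map_add' f g := by simp [tensorRightHomEquiv]
      map_smul' c f := by simp [tensorRightHomEquiv] }

theorem finrank_tensorLeft (A Y Y' B : C) [ExactPairing Y Y'] :
    Module.finrank ℂ (Y' ⊗ A ⟶ B) = Module.finrank ℂ (A ⟶ Y ⊗ B) :=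
  LinearEquiv.finrank_eq
    { tensorLeftHomEquiv A Y Y' B with
      map_add' f g := by simp [tensorLeftHomEquiv]
      map_smul' c f := by simp [tensorLeftHomEquiv] }

end

variable [RightRigidCategory C]

/-- The isomorphism of duals induced by an isomorphism. -/
def dualIso {V W : C} (e : V ≅ W) : Wᘁ ≅ Vᘁ where
  hom := e.homᘁ
  inv := e.invᘁ
  hom_inv_id := by rw [← comp_rightAdjointMate, e.inv_hom_id, rightAdjointMate_id]
  inv_hom_id := by rw [← comp_rightAdjointMate, e.hom_inv_id, rightAdjointMate_id]

variable [Preadditive C] [Linear ℂ C] [MonoidalPreadditive C] [MonoidalLinear ℂ C]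

theorem finrank_end_dual (V : C) :
    Module.finrank ℂ (Vᘁ ⟶ Vᘁ) = Module.finrank ℂ (V ⟶ V) := by
  rw [finrank_hom_congr (Iso.refl (Vᘁ)) (λ_ (Vᘁ)).symm, ← finrank_tensorRight (Vᘁ) V,
    finrank_tensorLeft V V, finrank_hom_congr (Iso.refl V) (ρ_ V)]

end Duals

section Fusion

variable {C : Type u} [Category.{v} C] [Abelian C] [Linear ℂ C] [MonoidalCategory C]
  [MonoidalPreadditive C] [MonoidalLinear ℂ C] [RightRigidCategory C] [FusionCategory C]

attribute [local instance] Abelian.hasFiniteBiproducts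

/-- In a semisimple category an object with `End V = ℂ` is simple. -/
theorem simple_of_finrank_end {V : C} (h : Module.finrank ℂ (V ⟶ V) = 1) : Simple V := by
  have hne : 𝟙 V ≠ 0 := by
    intro h0
    have : Subsingleton (V ⟶ V) :=
      ⟨fun a b => by rw [← Category.id_comp a, ← Category.id_comp b, h0]; simp⟩
    rw [Module.finrank_zero_of_subsingleton] at h
    exact zero_ne_one h
  obtain ⟨m, S, hS, ⟨e⟩⟩ := FusionCategory.semisimple V
  have hm : 0 < m := by
    rcases Nat.eq_zero_or_pos m with rfl | hm
    · exfalso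
      apply hne
      rw [← e.hom_inv_id, ← Category.id_comp e.inv, ← biproduct.total]
      simp
    · exact hm
  let a : Fin m := ⟨0, hm⟩
  have hr : (biproduct.ι S a ≫ e.inv) ≫ e.hom ≫ biproduct.π S a = 𝟙 (S a) := by simp
  -- the nonzero idempotent that projects to a simple summand is a scalar, hence the identity
  obtain ⟨c, hc⟩ : ∃ c : ℂ, (e.hom ≫ biproduct.π S a) ≫ biproduct.ι S a ≫ e.inv = c • 𝟙 V :=
    ⟨_, eq_endScalar_smul h _⟩
  have := hS a
  have hc1 : c • 𝟙 (S a) = 𝟙 (S a) := by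
    have h1 : (biproduct.ι S a ≫ e.inv) ≫ ((e.hom ≫ biproduct.π S a) ≫ biproduct.ι S a ≫ e.inv) ≫
        e.hom ≫ biproduct.π S a = 𝟙 (S a) := by simp
    rw [hc] at h1
    simpa using h1
  have hc2 : c = 1 := by
    have h2 : (c - 1) • 𝟙 (S a) = 0 := by rw [sub_smul, hc1, one_smul, sub_self]
    rcases smul_eq_zero.mp h2 with h3 | h3
    · exact sub_eq_zero.mp h3
    · exact absurd h3 (id_nonzero _)
  rw [hc2, one_smul] at hc
  exact Simple.of_iso ⟨_, _, hc, hr⟩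

theorem simple_dual {V : C} (hV : Simple V) : Simple (Vᘁ) :=
  simple_of_finrank_end (by rw [finrank_end_dual, FusionCategory.finrank_end V hV])

variable [PivotalCategory C] {Γ : Type w} {X : Γ → C}

/-- Duality is an involution on the set of simple objects. -/
theorem exists_dual_perm (hX : IsCompleteSimples X) :
    ∃ σ : Equiv.Perm Γ, ∀ i, Nonempty ((X i)ᘁ ≅ X (σ i)) ∧ Nonempty (X i ≅ (X (σ i))ᘁ) := by
  choose σ hσ using fun i => hX.exists_iso _ (simple_dual (hX.simple i))
  have h2 : ∀ i, Nonempty (X i ≅ (X (σ i))ᘁ) := fun i =>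
    ⟨PivotalCategory.j (X i) ≪≫ (dualIso (hσ i).some).symm⟩
  have hinv : Function.Involutive σ := fun i =>
    (hX.eq_of_iso _ _ ⟨(h2 i).some ≪≫ (hσ (σ i)).some⟩).symm
  exact ⟨hinv.toPerm, fun i => ⟨hσ i, h2 i⟩⟩

end Fusion

/-! ### Dimensions -/

section Dimension

variable {C : Type u} [Category.{v} C] [Preadditive C] [Linear ℂ C] [MonoidalCategory C]
  [MonoidalPreadditive C] [MonoidalLinear ℂ C] [RightRigidCategory C] [PivotalCategory C]

variable (C) in
/-- The left pivotal trace as a trace functional. -/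
def pivotalTrace : TraceFunctional C where
  toFun A :=
    { toFun f := endScalar (ptrL f)
      map_add' f g := by rw [ptrL_add, endScalar_add]
      map_smul' c f := by rw [ptrL_smul, endScalar_smul]; rfl }
  comm f g := by
    change endScalar _ = endScalar _
    rw [ptrL_comm]

variable (C) in
/-- The pivotal trace of the dual morphism, as a trace functional. -/
def dualTrace : TraceFunctional C where
  toFun A :=
    { toFun f := endScalar (ptrL (fᘁ))
      map_add' f g := by
        rw [← endScalar_add, ← ptrL_add]
        simp [rightAdjointMate]
      map_smul' c f := by
        rw [RingHom.id_apply, smul_eq_mul, ← endScalar_smul, ← ptrL_smul]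
        simp [rightAdjointMate] }
  comm f g := by
    change endScalar _ = endScalar _
    rw [comp_rightAdjointMate, comp_rightAdjointMate, ptrL_comm]

theorem pivotalTrace_apply {A : C} (f : A ⟶ A) :
    (pivotalTrace C).toFun A f = endScalar (ptrL f) := rfl

theorem pivotalTrace_tensor {V A : C} {f : V ⊗ A ⟶ V ⊗ A} {c : ℂ} (h : trL V f = c • 𝟙 A) :
    (pivotalTrace C).toFun (V ⊗ A) f = c * (pivotalTrace C).toFun A (𝟙 A) := by
  rw [pivotalTrace_apply, ptrL_tensor, h, ptrL_smul, endScalar_smul, pivotalTrace_apply]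

variable [SphericalCategory C]

theorem pivotalTrace_id (A : C) : (pivotalTrace C).toFun A (𝟙 A) = pdim A := by
  rw [pdim, SphericalCategory.ptr_eq, pivotalTrace_apply]

theorem dualTrace_id (A : C) : (dualTrace C).toFun A (𝟙 A) = pdim (Aᘁ) := by
  rw [pdim, SphericalCategory.ptr_eq, ← rightAdjointMate_id]
  rfl

theorem pdim_congr {A B : C} (e : A ≅ B) : pdim A = pdim B := by
  rw [← pivotalTrace_id, (pivotalTrace C).iso_eq e, pivotalTrace_id]

end Dimension

section FusionDimension

variable {C : Type u} [Category.{v} C] [Abelian C] [Linear ℂ C] [MonoidalCategory C]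
  [MonoidalPreadditive C] [MonoidalLinear ℂ C] [RightRigidCategory C] [PivotalCategory C]
  [FusionCategory C]

theorem ptrL_eq_smul {V : C} (f : V ⟶ V) :
    ptrL f = (pivotalTrace C).toFun V f • 𝟙 (𝟙_ C) :=
  eq_endScalar_smul (FusionCategory.finrank_end _ FusionCategory.simple_unit) _

variable [SphericalCategory C]

theorem trL_id (V A : C) : trL V (𝟙 (V ⊗ A)) = pdim V • 𝟙 A := by
  have h : trL V (𝟙 (V ⊗ A)) = (λ_ A).inv ≫ ptrL (𝟙 V) ▷ A ≫ (λ_ A).hom := by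
    rw [trL, ptrL_eq]; monoidal
  rw [h, ptrL_eq_smul, pivotalTrace_id]
  simp [MonoidalLinear.smul_whiskerRight]

theorem pdim_tensor (V A : C) : pdim (V ⊗ A) = pdim V * pdim A := by
  rw [← pivotalTrace_id, pivotalTrace_tensor (trL_id V A), pivotalTrace_id]

theorem pdim_tensor_dual (V A : C) : pdim ((V ⊗ Aᘁ)ᘁ) = pdim A * pdim (Vᘁ) := by
  rw [pdim_congr (rightDualTensorIso V (Aᘁ)), pdim_tensor, pdim_congr (PivotalCategory.j A).symm]

variable {Γ : Type w} [Fintype Γ] {X : Γ → C}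

/-- Summing the multiplicities of `X k` in `Y` against the dimensions. -/
theorem sum_finrank_mul_pdim (hX : IsCompleteSimples X) (Y : C) :
    ∑ k, (Module.finrank ℂ (X k ⟶ Y) : ℂ) * pdim (X k) = pdim Y := by
  rw [← pivotalTrace_id, (pivotalTrace C).id_eq_sum hX]
  simp_rw [pivotalTrace_id]

theorem sum_finrank_mul_pdim_dual (hX : IsCompleteSimples X) (Y : C) :
    ∑ k, (Module.finrank ℂ (Y ⟶ X k) : ℂ) * pdim ((X k)ᘁ) = pdim (Yᘁ) := by
  rw [← dualTrace_id, (dualTrace C).id_eq_sum_co hX]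
  simp_rw [dualTrace_id]

end FusionDimension

/-! ### Encircling and the S-matrix -/

section Encircle

variable {C : Type u} [Category.{v} C] [Preadditive C] [Linear ℂ C] [MonoidalCategory C]
  [MonoidalPreadditive C] [MonoidalLinear ℂ C] [BraidedCategory C] [RightRigidCategory C]
  [PivotalCategory C]

/-- For simple `A`: the scalar by which `A`, encircled by a strand coloured with `Y` that carries an
endomorphism of `Y`, acts. -/
def encircleTrace (A : C) : TraceFunctional C where
  toFun Y :=
    { toFun f := endScalar (trL Y (f ▷ A ≫ monodromy Y A))
      map_add' f g := by
        rw [MonoidalPreadditive.add_whiskerRight, Preadditive.add_comp, trL_add, endScalar_add]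
      map_smul' c f := by
        rw [MonoidalLinear.smul_whiskerRight, Linear.smul_comp, trL_smul, endScalar_smul]; rfl }
  comm {Y Z} f g := by
    change endScalar _ = endScalar _
    rw [comp_whiskerRight, Category.assoc, trL_slide, Category.assoc, ← monodromy_naturality_left,
      comp_whiskerRight, Category.assoc]

/-- The scalar by which a simple object `A`, encircled by `Y`, acts. -/
def encircle (A Y : C) : ℂ := (encircleTrace A).toFun Y (𝟙 Y)

theorem encircle_congr (A : C) {Y Z : C} (e : Y ≅ Z) : encircle A Y = encircle A Z :=
  (encircleTrace A).iso_eq e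

theorem pivotalTrace_monodromy_symm (A Y : C) :
    (pivotalTrace C).toFun (A ⊗ Y) (monodromy A Y) =
      (pivotalTrace C).toFun (Y ⊗ A) (monodromy Y A) :=
  (pivotalTrace C).comm _ _

end Encircle

section Fusion

variable {C : Type u} [Category.{v} C] [Abelian C] [Linear ℂ C] [MonoidalCategory C]
  [MonoidalPreadditive C] [MonoidalLinear ℂ C] [BraidedCategory C] [RightRigidCategory C]
  [PivotalCategory C] [FusionCategory C]

theorem trL_monodromy {A : C} (hA : Simple A) (Y : C) :
    trL Y (monodromy Y A) = encircle A Y • 𝟙 A := by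
  have h : encircle A Y = endScalar (trL Y (monodromy Y A)) := by
    change endScalar (trL Y (𝟙 Y ▷ A ≫ monodromy Y A)) = _
    rw [id_whiskerRight, Category.id_comp]
  rw [h]
  exact eq_endScalar_smul (FusionCategory.finrank_end A hA) _

/-- For simple `A`, encircling is multiplicative in the encircling object. -/
theorem encircle_tensor {A : C} (hA : Simple A) (Y Z : C) :
    encircle A (Y ⊗ Z) = encircle A Y * encircle A Z := by
  have h : (α_ Y Z A).inv ≫ monodromy (Y ⊗ Z) A ≫ (α_ Y Z A).hom =
      Y ◁ (β_ Z A).hom ≫ ((α_ Y A Z).inv ≫ monodromy Y A ▷ Z ≫ (α_ Y A Z).hom) ≫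
        Y ◁ (β_ A Z).hom := by
    rw [monodromy_tensor_left]; simp
  have h2 : trL (Y ⊗ Z) (monodromy (Y ⊗ Z) A) = (encircle A Y * encircle A Z) • 𝟙 A := by
    rw [trL_tensor, h, trL_whiskerLeft_comp, trL_comp_whiskerLeft, trL_whiskerRight,
      trL_monodromy hA, MonoidalLinear.smul_whiskerRight, id_whiskerRight, Linear.smul_comp,
      Linear.comp_smul, Category.id_comp, trL_smul]
    change _ • trL Z (monodromy Z A) = _
    rw [trL_monodromy hA, smul_smul]
  rw [trL_monodromy (A := A) hA] at h2
  have := congrArg endScalar h2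
  rwa [endScalar_smul, endScalar_smul, endScalar_id (FusionCategory.finrank_end A hA), mul_one,
    mul_one] at this

variable [SphericalCategory C]

theorem pivotalTrace_monodromy {A : C} (hA : Simple A) (Y : C) :
    (pivotalTrace C).toFun (Y ⊗ A) (monodromy Y A) = encircle A Y * pdim A := by
  rw [pivotalTrace_tensor (trL_monodromy hA Y), pivotalTrace_id]

/-- A strand isomorphic to the unit is not linked with anything. -/
theorem encircle_of_iso_unit {A : C} (e : 𝟙_ C ≅ A) (Y : C) : encircle A Y = pdim Y := by
  have h1 : monodromy Y A = 𝟙 _ := by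
    have h := monodromy_naturality_right Y e.hom
    have hu : monodromy Y (𝟙_ C) = 𝟙 _ := by
      simp [monodromy, braiding_tensorUnit_left, braiding_tensorUnit_right]
    rw [hu, Category.id_comp] at h
    rw [← cancel_epi (Y ◁ e.hom)]
    exact h.trans (Category.comp_id _).symm
  have hA : Simple A := by
    have := FusionCategory.simple_unit (C := C)
    exact Simple.of_iso e.symm
  have h2 := trL_monodromy hA Y
  rw [h1] at h2
  have h3 := (trL_id Y A).symm.trans h2
  have := congrArg endScalar h3
  rw [endScalar_smul, endScalar_smul, endScalar_id (FusionCategory.finrank_end A hA), mul_one,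
    mul_one] at this
  exact this.symm

end Fusion

section Modular

variable {C : Type u} [Category.{v} C] [Abelian C] [Linear ℂ C] [MonoidalCategory C]
  [MonoidalPreadditive C] [MonoidalLinear ℂ C] [BraidedCategory C] [RightRigidCategory C]
  [PivotalCategory C] [ModularTensorCategory C] {Γ : Type w} {X : Γ → C}

theorem sMatrix_apply (hX : IsCompleteSimples X) (i j : Γ) :
    sMatrix X i j = encircle (X j) ((X i)ᘁ) * pdim (X j) := by
  rw [← pivotalTrace_monodromy (hX.simple j)]
  change endScalar (ptrR _) = endScalar (ptrL _)
  rw [SphericalCategory.ptr_eq]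

theorem exists_iso_unit (hX : IsCompleteSimples X) : ∃ i₀, Nonempty (𝟙_ C ≅ X i₀) :=
  hX.exists_iso _ FusionCategory.simple_unit

variable [Fintype Γ]

theorem isUnit_sMatrix [DecidableEq Γ] (hX : IsCompleteSimples X) : IsUnit (sMatrix X) := by
  let e := (Fintype.equivFin Γ).symm
  have h : IsCompleteSimples (X ∘ e) :=
    { simple := fun i => hX.simple _
      eq_of_iso := fun i k hik => e.injective (hX.eq_of_iso _ _ hik)
      exists_iso := fun Y hY => by
        obtain ⟨i, hi⟩ := hX.exists_iso Y hY
        exact ⟨e.symm i, by simpa using hi⟩ }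
  have h2 := ModularTensorCategory.nonsingular _ _ h
  have h3 : sMatrix (X ∘ e) = (sMatrix X).submatrix e e := rfl
  rwa [h3, Matrix.isUnit_submatrix_equiv] at h2

theorem pdim_ne_zero (hX : IsCompleteSimples X) (j : Γ) : pdim (X j) ≠ 0 := by
  classical
  intro h
  have hinj := Matrix.mulVec_injective_iff_isUnit.mpr (isUnit_sMatrix hX)
  have h0 : (sMatrix X).mulVec (Pi.single j 1) = (sMatrix X).mulVec 0 := by
    ext i
    simp [sMatrix_apply hX, h]
  have := congrFun (hinj h0) j
  simp at this

theorem pdim_ne_zero_of_simple (hX : IsCompleteSimples X) {V : C} (hV : Simple V) :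
    pdim V ≠ 0 := by
  obtain ⟨i, ⟨e⟩⟩ := hX.exists_iso V hV
  rw [pdim_congr e]
  exact pdim_ne_zero hX i

theorem pdim_unit (hX : IsCompleteSimples X) : pdim (𝟙_ C) = 1 := by
  have h := pdim_tensor (𝟙_ C) (𝟙_ C)
  rw [pdim_congr (λ_ (𝟙_ C))] at h
  have h0 := pdim_ne_zero_of_simple hX (FusionCategory.simple_unit (C := C))
  exact (mul_eq_left₀ h0).mp h.symm

/-- The scalar by which `X j` acts when encircled by `∑ₖ d((X k)ᘁ) X k`. -/
def kirbyScalar (X : Γ → C) (j : Γ) : ℂ := ∑ k, pdim ((X k)ᘁ) * encircle (X j) (X k)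

/-- The element `∑ₖ d((X k)ᘁ) X k` absorbs `X a` at the cost of a factor `d(X a)`. -/
theorem kirbyScalar_mul (hX : IsCompleteSimples X) (j a : Γ) :
    kirbyScalar X j * encircle (X j) (X a) = pdim (X a) * kirbyScalar X j := by
  have h1 : ∀ k, encircle (X j) (X k) * encircle (X j) (X a) =
      ∑ c, (Module.finrank ℂ (X c ⊗ (X a)ᘁ ⟶ X k) : ℂ) * encircle (X j) (X c) := by
    intro k
    have := pivotalPairing (X a)
    rw [← encircle_tensor (hX.simple j), encircle, (encircleTrace (X j)).id_eq_sum hX]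
    simp_rw [finrank_tensorRight _ ((X a)ᘁ) (X a)]
    rfl
  simp_rw [kirbyScalar, Finset.sum_mul, mul_assoc, h1, Finset.mul_sum]
  rw [Finset.sum_comm]
  refine Finset.sum_congr rfl fun c _ => ?_
  rw [← mul_assoc, ← pdim_tensor_dual, ← sum_finrank_mul_pdim_dual hX, Finset.sum_mul]
  exact Finset.sum_congr rfl fun k _ => by ring

theorem kirbyScalar_unit {i₀ : Γ} (e : 𝟙_ C ≅ X i₀) : kirbyScalar X i₀ = globalDim X := by
  rw [kirbyScalar, globalDim]
  refine Finset.sum_congr rfl fun k _ => ?_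
  rw [encircle_of_iso_unit e, mul_comm]

/-- Encircling with `∑ₖ d((X k)ᘁ) X k` kills all simple objects other than the unit. -/
theorem kirbyScalar_eq_zero (hX : IsCompleteSimples X) {i₀ : Γ} (e : 𝟙_ C ≅ X i₀) {j : Γ}
    (hj : j ≠ i₀) : kirbyScalar X j = 0 := by
  classical
  by_contra h
  have h1 : ∀ a, encircle (X j) (X a) = pdim (X a) := fun a =>
    mul_left_cancel₀ h ((kirbyScalar_mul hX j a).trans (mul_comm _ _))
  have h2 : ∀ Y : C, encircle (X j) Y = pdim Y := by
    intro Y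
    rw [← sum_finrank_mul_pdim hX, encircle, (encircleTrace (X j)).id_eq_sum hX]
    exact Finset.sum_congr rfl fun k _ => congrArg _ (h1 k)
  -- the columns of the S-matrix at `j` and at the unit are proportional
  have hinj := Matrix.mulVec_injective_iff_isUnit.mpr (isUnit_sMatrix hX)
  have h0 : (sMatrix X).mulVec (Pi.single j (pdim (X i₀))) =
      (sMatrix X).mulVec (Pi.single i₀ (pdim (X j))) := by
    ext i
    simp [sMatrix_apply hX, h2, encircle_of_iso_unit e]
    ring
  have := congrFun (hinj h0) j
  rw [Pi.single_eq_same, Pi.single_eq_of_ne hj] at this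
  exact pdim_ne_zero hX i₀ this

theorem globalDim_ne_zero (hX : IsCompleteSimples X) : globalDim X ≠ 0 := by
  classical
  intro hD
  obtain ⟨i₀, ⟨e⟩⟩ := exists_iso_unit hX
  have h0 : ∀ j, kirbyScalar X j = 0 := by
    intro j
    by_cases hj : j = i₀
    · rw [hj, kirbyScalar_unit e, hD]
    · exact kirbyScalar_eq_zero hX e hj
  obtain ⟨σ, hσ⟩ := exists_dual_perm hX
  have hinj := Matrix.vecMul_injective_iff_isUnit.mpr (isUnit_sMatrix hX)
  have h1 : (sMatrix X).vecMul (fun i => pdim ((X (σ i))ᘁ)) = (sMatrix X).vecMul 0 := by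
    ext j
    rw [Matrix.zero_vecMul, Pi.zero_apply, ← zero_mul (pdim (X j)), ← h0 j, kirbyScalar,
      ← Equiv.sum_comp σ, Finset.sum_mul]
    refine Finset.sum_congr rfl fun i _ => ?_
    change pdim _ * sMatrix X i j = _
    rw [sMatrix_apply hX, encircle_congr _ (hσ i).1.some, mul_assoc]
  have h2 := congrFun (hinj h1) i₀
  exact pdim_ne_zero_of_simple hX (simple_dual (hX.simple (σ i₀))) h2

variable (X) in
/-- The pivotal trace of an endomorphism of `A` encircled by `∑ₖ d((X k)ᘁ) X k`. -/
def kirbyTrace : TraceFunctional C where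
  toFun A :=
    { toFun f := ∑ k, pdim ((X k)ᘁ) *
        (pivotalTrace C).toFun (A ⊗ X k) (f ▷ X k ≫ monodromy A (X k))
      map_add' f g := by
        simp only [MonoidalPreadditive.add_whiskerRight, Preadditive.add_comp, map_add, mul_add,
          Finset.sum_add_distrib]
      map_smul' c f := by
        simp only [MonoidalLinear.smul_whiskerRight, Linear.smul_comp, map_smul, smul_eq_mul,
          RingHom.id_apply, Finset.mul_sum]
        exact Finset.sum_congr rfl fun k _ => by ring }
  comm {A B} f g := by
    change ∑ k, _ = ∑ k, _
    refine Finset.sum_congr rfl fun k _ => ?_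
    rw [comp_whiskerRight, Category.assoc, (pivotalTrace C).comm, Category.assoc,
      ← monodromy_naturality_left, comp_whiskerRight, Category.assoc]

/-- Encircling with `∑ₖ d((X k)ᘁ) X k` cuts out the unit: it turns the pivotal trace into
`dim C` times the trace on `Hom(𝟙, A)`. -/
theorem kirbyTrace_apply (hX : IsCompleteSimples X) {A : C} (f : A ⟶ A) :
    (kirbyTrace X).toFun A f = globalDim X * (homTrace (𝟙_ C)).toFun A f := by
  classical
  obtain ⟨i₀, ⟨e⟩⟩ := exists_iso_unit hX
  have hval : ∀ i, (kirbyTrace X).toFun (X i) (𝟙 (X i)) = if i₀ = i then globalDim X else 0 := by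
    intro i
    have : (kirbyTrace X).toFun (X i) (𝟙 (X i)) = kirbyScalar X i * pdim (X i) := by
      change ∑ k, _ = _
      rw [kirbyScalar, Finset.sum_mul]
      refine Finset.sum_congr rfl fun k _ => ?_
      rw [id_whiskerRight, Category.id_comp, pivotalTrace_monodromy_symm,
        pivotalTrace_monodromy (hX.simple i), mul_assoc]
    rw [this]
    split_ifs with h
    · subst h
      rw [kirbyScalar_unit e, ← pdim_congr e, pdim_unit hX, mul_one]
    · rw [kirbyScalar_eq_zero hX e (Ne.symm h), zero_mul]
  have hunit : ∀ i, (homTrace (𝟙_ C)).toFun (X i) (𝟙 (X i)) = if i₀ = i then 1 else 0 := by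
    intro i
    rw [homTrace_id, finrank_hom_congr e (Iso.refl (X i)), finrank_simple_hom hX]
    split_ifs <;> simp
  rw [(kirbyTrace X).eq_sum_homTrace hX, (homTrace (𝟙_ C)).eq_sum_homTrace hX]
  simp_rw [hval, hunit]
  simp [mul_comm]

end Modular

/-! ### The exponent -/

section Exponent

variable {C : Type u} [Category.{v} C] [MonoidalCategory C]

theorem center_monodromy_pow_of_exponent {N : ℕ} (hN : (N : ℕ∞) = exponent C) :
    0 < N ∧ ∀ V W : Center C, monodromy V W ^ N = 1 := by
  by_contra h
  have h1 : ((N + 1 : ℕ) : ℕ∞) ≤ exponent C := by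
    refine le_iInf₂ fun n hn => ?_
    have h2 : (N : ℕ∞) ≤ n := hN.trans_le (iInf₂_le n hn)
    rw [Nat.cast_le] at h2 ⊢
    refine Nat.succ_le_of_lt (lt_of_le_of_ne h2 ?_)
    rintro rfl
    exact h hn
  rw [← hN, Nat.cast_le] at h1
  omega

/-- A braided category maps to its Drinfeld center, so its monodromies have order dividing the
exponent. -/
theorem monodromy_pow_of_exponent [BraidedCategory C] {N : ℕ} (hN : (N : ℕ∞) = exponent C)
    (V W : C) : monodromy V W ^ N = 1 := by
  have h := (center_monodromy_pow_of_exponent hN).2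
    ((Center.ofBraided C).obj V) ((Center.ofBraided C).obj W)
  have h1 := congrArg (Functor.mapEnd _ (Center.forget C)) h
  rw [map_pow, map_one] at h1
  exact h1

end Exponent

/-! ### Twist scalars of simple objects -/

section TwistScalar

variable {C : Type u} [Category.{v} C] [Abelian C] [Linear ℂ C] [MonoidalCategory C]
  [MonoidalPreadditive C] [MonoidalLinear ℂ C] [BraidedCategory C] [RightRigidCategory C]
  [PivotalCategory C]

theorem coevL_eq_smul {V : C} {τ : ℂ} (hτ : twistL V = τ • 𝟙 V) :
    coevL V = τ • (η_ V (Vᘁ) ≫ (β_ V (Vᘁ)).hom) := by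
  rw [← rotate_coev, rotate_eq, hτ]
  simp [MonoidalLinear.smul_whiskerRight]

variable [ModularTensorCategory C]

theorem twist_eq_smul {V : C} (hV : Simple V) : twist V = twistScalar V • 𝟙 V :=
  eq_endScalar_smul (FusionCategory.finrank_end V hV) _

theorem coevL_comp_eval (V : C) : coevL V ≫ ε_ V (Vᘁ) = pdim V • 𝟙 (𝟙_ C) := by
  rw [← pivotalTrace_id, ← ptrL_eq_smul, ptrL_eq]; simp

theorem coev_comp_evR (V : C) : η_ V (Vᘁ) ≫ evR V = pdim V • 𝟙 (𝟙_ C) := by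
  rw [← pivotalTrace_id, ← ptrL_eq_smul, ← SphericalCategory.ptr_eq, ptrR_eq]; simp

theorem smul_unit_injective {a b c : ℂ} (hc : c ≠ 0) {x : 𝟙_ C ⟶ 𝟙_ C}
    (ha : a • x = c • 𝟙 (𝟙_ C)) (hb : b • x = c • 𝟙 (𝟙_ C)) : a = b := by
  have h1 : endScalar (𝟙 (𝟙_ C)) = 1 :=
    endScalar_id (FusionCategory.finrank_end _ FusionCategory.simple_unit)
  have ha := congrArg endScalar ha
  have hb := congrArg endScalar hb
  rw [endScalar_smul, endScalar_smul, h1, mul_one] at ha hb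
  refine mul_right_cancel₀ (b := endScalar x) ?_ (ha.trans hb.symm)
  rintro h
  rw [h, mul_zero] at ha
  exact hc ha.symm

variable {Γ : Type w} [Fintype Γ] {X : Γ → C}

/-- By sphericality the left trace of the self-braiding is the twist. -/
theorem twistL_eq_smul (hX : IsCompleteSimples X) {V : C} (hV : Simple V) :
    twistL V = twistScalar V • 𝟙 V := by
  obtain ⟨τ, hτ⟩ : ∃ τ : ℂ, twistL V = τ • 𝟙 V :=
    ⟨_, eq_endScalar_smul (FusionCategory.finrank_end V hV) _⟩
  have h1 : τ • (η_ V (Vᘁ) ≫ (β_ V (Vᘁ)).hom ≫ ε_ V (Vᘁ)) = pdim V • 𝟙 (𝟙_ C) := by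
    rw [← coevL_comp_eval, coevL_eq_smul hτ, Linear.smul_comp, Category.assoc]
  have h2 : twistScalar V • (η_ V (Vᘁ) ≫ (β_ V (Vᘁ)).hom ≫ ε_ V (Vᘁ)) = pdim V • 𝟙 (𝟙_ C) := by
    rw [← coev_comp_evR, ← twist_comp_braiding_comp_eval, twist_eq_smul hV]
    simp [MonoidalLinear.smul_whiskerRight]
  rw [hτ, smul_unit_injective (pdim_ne_zero_of_simple hX hV) h1 h2]

theorem twistScalar_ne_zero (hX : IsCompleteSimples X) {V : C} (hV : Simple V) :
    twistScalar V ≠ 0 := by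
  intro h
  have h1 := coevL_comp_eval V
  have h2 := twistL_eq_smul hX hV
  rw [h] at h2
  rw [coevL_eq_smul h2, zero_smul, zero_comp] at h1
  have h3 := FusionCategory.simple_unit (C := C)
  rcases smul_eq_zero.mp h1.symm with h4 | h4
  · exact pdim_ne_zero_of_simple hX hV h4
  · exact id_nonzero _ h4

theorem twistScalar_congr (hX : IsCompleteSimples X) {V W : C} (hV : Simple V) (e : V ≅ W) :
    twistScalar V = twistScalar W := by
  have hW : Simple W := Simple.of_iso e.symm
  have h := twistL_naturality e.hom
  rw [twistL_eq_smul hX hV, twistL_eq_smul hX hW, Linear.comp_smul, Category.comp_id,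
    Linear.smul_comp, Category.id_comp] at h
  have h1 : twistScalar V • 𝟙 V = twistScalar W • 𝟙 V := by
    rw [← e.hom_inv_id, ← Linear.smul_comp, ← Linear.smul_comp, h]
  have h2 := congrArg endScalar h1
  rwa [endScalar_smul, endScalar_smul, endScalar_id (FusionCategory.finrank_end V hV), mul_one,
    mul_one] at h2

theorem twistL_tensor_eq_smul (hX : IsCompleteSimples X) {V W : C} (hV : Simple V)
    (hW : Simple W) :
    twistL (V ⊗ W) = (twistScalar V * twistScalar W) • (monodromy V W : V ⊗ W ⟶ V ⊗ W) := by
  rw [twistL_tensor, twistL_eq_smul hX hV, twistL_eq_smul hX hW, MonoidalCategory.tensorHom_def]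
  simp [MonoidalLinear.smul_whiskerRight, MonoidalLinear.whiskerLeft_smul, smul_smul, mul_comm]

theorem twistL_unit_eq (hX : IsCompleteSimples X) : twistL (𝟙_ C) = 𝟙 (𝟙_ C) := by
  rw [twistL_unit, ptrL_eq_smul, pivotalTrace_id, pdim_unit hX, one_smul]

theorem twistScalar_unit (hX : IsCompleteSimples X) : twistScalar (𝟙_ C) = 1 := by
  have hs := FusionCategory.simple_unit (C := C)
  have h := twistL_eq_smul hX hs
  rw [twistL_unit_eq hX] at h
  have h2 := congrArg endScalar h
  rw [endScalar_smul, endScalar_id (FusionCategory.finrank_end _ hs), mul_one] at h2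
  exact h2.symm

/-- A simple object and its dual have the same twist, by balancing on `Vᘁ ⊗ V` and the equality of
left and right dimension. -/
theorem twistScalar_dual (hX : IsCompleteSimples X) {V : C} (hV : Simple V) :
    twistScalar (Vᘁ) = twistScalar V := by
  have hV' := simple_dual hV
  have hτ := twistL_eq_smul hX hV
  have h0 := twistScalar_ne_zero hX hV
  -- the twist of `Vᘁ ⊗ V` is trivial on the coevaluation
  have h1 : twistScalar (Vᘁ) • (coevL V ≫ (β_ (Vᘁ) V).hom) = η_ V (Vᘁ) := by
    have h := twistL_naturality (coevL V)
    rw [twistL_unit_eq hX, Category.id_comp, twistL_tensor_eq_smul hX hV' hV, Linear.comp_smul,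
      mul_comm, ← smul_smul, monodromy] at h
    conv_rhs at h => rw [coevL_eq_smul hτ]
    have h2 := smul_right_injective _ h0 h
    rw [← cancel_mono (β_ V (Vᘁ)).hom, Linear.smul_comp, Category.assoc]
    exact h2
  have h3 : twistScalar V • (β_ (Vᘁ) V).hom ≫ evR V = ε_ V (Vᘁ) := by
    have h := twistL_comp_evR V
    rw [hτ, MonoidalLinear.smul_whiskerRight, id_whiskerRight, Linear.smul_comp,
      Category.id_comp] at h
    rw [← Linear.comp_smul, h, Iso.hom_inv_id_assoc]
  refine smul_unit_injective (pdim_ne_zero_of_simple hX hV)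
    (x := coevL V ≫ (β_ (Vᘁ) V).hom ≫ evR V) ?_ ?_
  · rw [← coev_comp_evR, ← h1, Linear.smul_comp, Category.assoc]
  · rw [← coevL_comp_eval, ← Linear.comp_smul, h3]

/-- The monodromy acts on each simple constituent of `V ⊗ W` by a ratio of twists. -/
theorem comp_monodromy (hX : IsCompleteSimples X) {V W Z : C} (hV : Simple V) (hW : Simple W)
    (hZ : Simple Z) (f : Z ⟶ V ⊗ W) :
    f ≫ (monodromy V W : V ⊗ W ⟶ V ⊗ W) =
      (twistScalar Z / (twistScalar V * twistScalar W)) • f := by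
  have h0 := mul_ne_zero (twistScalar_ne_zero hX hV) (twistScalar_ne_zero hX hW)
  have h := twistL_naturality f
  rw [twistL_tensor_eq_smul hX hV hW, twistL_eq_smul hX hZ, Linear.comp_smul, Linear.smul_comp,
    Category.id_comp] at h
  rw [div_eq_inv_mul, ← smul_smul, ← h, smul_smul, inv_mul_cancel₀ h0, one_smul]

theorem comp_monodromy_pow (hX : IsCompleteSimples X) {V W Z : C} (hV : Simple V) (hW : Simple W)
    (hZ : Simple Z) (f : Z ⟶ V ⊗ W) (n : ℕ) :
    f ≫ (monodromy V W ^ n : End (V ⊗ W)) =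
      (twistScalar Z / (twistScalar V * twistScalar W)) ^ n • f := by
  induction n with
  | zero => rw [pow_zero, pow_zero, one_smul]; exact Category.comp_id f
  | succ n ih =>
    rw [pow_succ', End.mul_def, reassoc_of% ih, Linear.smul_comp, comp_monodromy hX hV hW hZ,
      smul_smul, pow_succ]

theorem pivotalTrace_monodromy_pow (hX : IsCompleteSimples X) (j k : Γ) (n : ℕ) :
    (pivotalTrace C).toFun (X j ⊗ X k) (monodromy (X j) (X k) ^ n : End (X j ⊗ X k)) =
      ∑ l, (Module.finrank ℂ (X l ⟶ X j ⊗ X k) : ℂ) * pdim (X l) *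
        (twistScalar (X l) / (twistScalar (X j) * twistScalar (X k))) ^ n := by
  rw [(pivotalTrace C).eq_sum_homTrace hX]
  refine Finset.sum_congr rfl fun l _ => ?_
  have h : Linear.rightComp ℂ (X l) (monodromy (X j) (X k) ^ n : End (X j ⊗ X k)) =
      (twistScalar (X l) / (twistScalar (X j) * twistScalar (X k))) ^ n • LinearMap.id := by
    ext f
    exact comp_monodromy_pow hX (hX.simple j) (hX.simple k) (hX.simple l) f n
  change LinearMap.trace ℂ (X l ⟶ X j ⊗ X k) (Linear.rightComp ℂ (X l) _) * _ = _
  rw [h, map_smul, LinearMap.trace_id, pivotalTrace_id, smul_eq_mul]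
  ring

/-! ### The indicator formula -/

theorem trace_rotate (hX : IsCompleteSimples X) {V : C} (hV : Simple V) {W : C}
    (s : W ⊗ V ⟶ V ⊗ W) :
    LinearMap.trace ℂ (𝟙_ C ⟶ V ⊗ W) (Linear.rightComp ℂ (𝟙_ C) s ∘ₗ rotate V W) =
      twistScalar V * (homTrace (𝟙_ C)).toFun (V ⊗ W) ((β_ V W).hom ≫ s) := by
  have h : Linear.rightComp ℂ (𝟙_ C) s ∘ₗ rotate V W =
      twistScalar V • Linear.rightComp ℂ (𝟙_ C) ((β_ V W).hom ≫ s) := by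
    ext f
    change rotate V W f ≫ s = twistScalar V • (f ≫ (β_ V W).hom ≫ s)
    rw [rotate_eq, twistL_eq_smul hX hV]
    simp [MonoidalLinear.smul_whiskerRight]
  rw [h, map_smul, smul_eq_mul]
  rfl

theorem fsIndicator_succ (hX : IsCompleteSimples X) {V : C} (hV : Simple V) (n : ℕ) :
    fsIndicator (n + 1) V = twistScalar V * (homTrace (𝟙_ C)).toFun (V ⊗ tpow V n)
      ((β_ V (tpow V n)).hom ≫ (tpowShift V n).hom) :=
  trace_rotate hX hV _

/-- The indicator formula before relabelling `X k` by its dual. -/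
theorem globalDim_mul_fsIndicator (hX : IsCompleteSimples X) (j : Γ) {n : ℕ} (hn : 0 < n) :
    globalDim X * fsIndicator n (X j) =
      ∑ k, ∑ l, (Module.finrank ℂ (X l ⟶ X j ⊗ X k) : ℂ) * pdim (X l) * pdim ((X k)ᘁ) *
        (twistScalar (X l) / twistScalar (X k)) ^ n := by
  obtain ⟨m, rfl⟩ : ∃ m, n = m + 1 := ⟨n - 1, by omega⟩
  have hj := hX.simple j
  rw [fsIndicator_succ hX hj, mul_left_comm, ← kirbyTrace_apply hX]
  change _ * ∑ k, _ = _
  rw [Finset.mul_sum]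
  refine Finset.sum_congr rfl fun k _ => ?_
  have h1 : (pivotalTrace C).toFun ((X j ⊗ tpow (X j) m) ⊗ X k)
      (((β_ (X j) (tpow (X j) m)).hom ≫ (tpowShift (X j) m).hom) ▷ X k ≫
        monodromy (X j ⊗ tpow (X j) m) (X k)) =
      twistScalar (X j) ^ m * (pivotalTrace C).toFun (X j ⊗ X k)
        (monodromy (X j) (X k) ^ (m + 1) : End (X j ⊗ X k)) := by
    rw [(pivotalTrace C).comm, pivotalTrace_apply,
      ptrL_rotation_closure _ _ (twistL_eq_smul hX hj), endScalar_smul, pivotalTrace_apply]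
  have h0 := twistScalar_ne_zero hX hj
  have hk := twistScalar_ne_zero hX (hX.simple k)
  rw [h1, pivotalTrace_monodromy_pow hX, Finset.mul_sum, Finset.mul_sum, Finset.mul_sum]
  refine Finset.sum_congr rfl fun l _ => ?_
  rw [div_pow, div_pow, mul_pow]
  field_simp
  ring

theorem fsIndicator_eq (hX : IsCompleteSimples X) (j : Γ) {n : ℕ} (hn : 0 < n) :
    fsIndicator n (X j) = 1 / globalDim X * ∑ i, ∑ k, (fusionCoeff X i k j : ℂ) *
      pdim (X i) * pdim (X k) * (twistScalar (X i) / twistScalar (X k)) ^ n := by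
  obtain ⟨σ, hσ⟩ := exists_dual_perm hX
  rw [one_div, eq_inv_mul_iff_mul_eq₀ (globalDim_ne_zero hX), globalDim_mul_fsIndicator hX j hn]
  conv_rhs => rw [Finset.sum_comm]
  rw [← Equiv.sum_comp σ]
  refine Finset.sum_congr rfl fun k _ => Finset.sum_congr rfl fun i _ => ?_
  have h1 : Module.finrank ℂ (X i ⟶ X j ⊗ X (σ k)) = fusionCoeff X i k j := by
    rw [fusionCoeff, finrank_tensorRight (X i) (X k) ((X k)ᘁ)]
    exact finrank_hom_congr (Iso.refl _) (whiskerLeftIso (X j) (hσ k).1.some.symm)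
  have h2 : twistScalar (X (σ k)) = twistScalar (X k) := by
    rw [← twistScalar_congr hX (simple_dual (hX.simple k)) (hσ k).1.some,
      twistScalar_dual hX (hX.simple k)]
  rw [h1, h2, ← pdim_congr (hσ k).2.some]

/-! ### Powers of the twist -/

theorem sum_fusionCoeff_mul (hX : IsCompleteSimples X) (j : Γ) :
    ∑ i, ∑ k, (fusionCoeff X i k j : ℂ) * pdim (X i) * pdim (X k) =
      globalDim X * pdim (X j) := by
  rw [Finset.sum_comm, globalDim, Finset.sum_mul]
  refine Finset.sum_congr rfl fun k _ => ?_
  rw [← Finset.sum_mul]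
  simp_rw [fusionCoeff, finrank_tensorRight _ (X k) ((X k)ᘁ)]
  rw [sum_finrank_mul_pdim hX, pdim_tensor]
  ring

theorem twistScalar_pow_mul (hX : IsCompleteSimples X) {N : ℕ}
    (hN : ∀ V W : C, monodromy V W ^ N = 1) {V W Z : C} (hV : Simple V) (hW : Simple W)
    (hZ : Simple Z) {f : Z ⟶ V ⊗ W} (hf : f ≠ 0) :
    twistScalar V ^ N * twistScalar W ^ N = twistScalar Z ^ N := by
  have h := comp_monodromy_pow hX hV hW hZ f N
  rw [hN, End.one_def, Category.comp_id] at h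
  have h1 : ((twistScalar Z / (twistScalar V * twistScalar W)) ^ N - 1) • f = 0 := by
    rw [sub_smul, ← h, one_smul, sub_self]
  have h2 := sub_eq_zero.mp ((smul_eq_zero.mp h1).resolve_right hf)
  have h0 := pow_ne_zero N (mul_ne_zero (twistScalar_ne_zero hX hV) (twistScalar_ne_zero hX hW))
  rw [div_pow, div_eq_one_iff_eq h0, mul_pow] at h2
  exact h2.symm

theorem twistScalar_pow_mul_of_fusionCoeff (hX : IsCompleteSimples X) {N : ℕ}
    (hN : ∀ V W : C, monodromy V W ^ N = 1) {i k j : Γ} (h : fusionCoeff X i k j ≠ 0) :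
    twistScalar (X i) ^ N = twistScalar (X j) ^ N * twistScalar (X k) ^ N := by
  rw [fusionCoeff, finrank_tensorRight (X i) (X k) ((X k)ᘁ)] at h
  have : Nontrivial (X i ⟶ X j ⊗ (X k)ᘁ) := Module.nontrivial_of_finrank_pos (Nat.pos_of_ne_zero h)
  obtain ⟨f, hf⟩ := exists_ne (0 : X i ⟶ X j ⊗ (X k)ᘁ)
  rw [← twistScalar_pow_mul hX hN (hX.simple j) (simple_dual (hX.simple k)) (hX.simple i) hf,
    twistScalar_dual hX (hX.simple k)]

theorem twistScalar_pow_mul_self (hX : IsCompleteSimples X) {N : ℕ}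
    (hN : ∀ V W : C, monodromy V W ^ N = 1) {V : C} (hV : Simple V) :
    twistScalar V ^ N * twistScalar V ^ N = 1 := by
  have hf : coevL V ≠ 0 := by
    intro h
    have h1 := coevL_comp_eval V
    rw [h, zero_comp] at h1
    have h3 := FusionCategory.simple_unit (C := C)
    rcases smul_eq_zero.mp h1.symm with h4 | h4
    · exact pdim_ne_zero_of_simple hX hV h4
    · exact id_nonzero _ h4
  have h := twistScalar_pow_mul hX hN (simple_dual hV) hV FusionCategory.simple_unit hf
  rwa [twistScalar_unit hX, one_pow, twistScalar_dual hX hV] at h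

theorem fsIndicator_of_monodromy_pow (hX : IsCompleteSimples X) {N : ℕ} (hN0 : 0 < N)
    (hN : ∀ V W : C, monodromy V W ^ N = 1) (j : Γ) :
    fsIndicator N (X j) = twistScalar (X j) ^ N * pdim (X j) := by
  have h : ∀ i k : Γ, (fusionCoeff X i k j : ℂ) * pdim (X i) * pdim (X k) *
      (twistScalar (X i) / twistScalar (X k)) ^ N =
      twistScalar (X j) ^ N * ((fusionCoeff X i k j : ℂ) * pdim (X i) * pdim (X k)) := by
    intro i k
    by_cases h0 : fusionCoeff X i k j = 0
    · simp [h0]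
    · have hk := pow_ne_zero N (twistScalar_ne_zero hX (hX.simple k))
      rw [div_pow, twistScalar_pow_mul_of_fusionCoeff hX hN h0, mul_div_cancel_right₀ _ hk,
        mul_comm]
  rw [fsIndicator_eq hX j hN0]
  simp_rw [h, ← Finset.mul_sum]
  rw [sum_fusionCoeff_mul hX]
  have := globalDim_ne_zero hX
  field_simp

end TwistScalar

end FrobSchur

end


theorem theoremt {C : Type u} [Category.{v} C] [Abelian C] [Linear ℂ C] [MonoidalCategory C]
    [MonoidalPreadditive C] [MonoidalLinear ℂ C] [BraidedCategory C] [RightRigidCategory C]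
    [FrobSchur.PivotalCategory C] [FrobSchur.ModularTensorCategory C]
    {Γ : Type w} [Fintype Γ] (X : Γ → C) (hX : FrobSchur.IsCompleteSimples X) :
    (∀ (j : Γ) (n : ℕ), 0 < n →
      FrobSchur.fsIndicator n (X j) =
        1 / FrobSchur.globalDim X *
          ∑ i, ∑ k, (FrobSchur.fusionCoeff X i k j : ℂ) *
            FrobSchur.pdim (X i) * FrobSchur.pdim (X k) *
            (FrobSchur.twistScalar (X i) / FrobSchur.twistScalar (X k)) ^ n) ∧
    (∀ N : ℕ, (N : ℕ∞) = FrobSchur.exponent C → ∀ j : Γ,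
      FrobSchur.fsIndicator N (X j) =
        FrobSchur.twistScalar (X j) ^ N * FrobSchur.pdim (X j) ∧
      (FrobSchur.twistScalar (X j) ^ N * FrobSchur.pdim (X j) = FrobSchur.pdim (X j) ∨
        FrobSchur.twistScalar (X j) ^ N * FrobSchur.pdim (X j) = -FrobSchur.pdim (X j))) := by
  refine ⟨fun j n hn => FrobSchur.fsIndicator_eq hX j hn, fun N hN j => ?_⟩
  have hpos := (FrobSchur.center_monodromy_pow_of_exponent hN).1
  have hmon := FrobSchur.monodromy_pow_of_exponent hN
  refine ⟨FrobSchur.fsIndicator_of_monodromy_pow hX hpos hmon j, ?_⟩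
  rcases mul_self_eq_one_iff.mp
    (FrobSchur.twistScalar_pow_mul_self hX hmon (hX.simple j)) with h | h
  · exact Or.inl (by rw [h, one_mul])
  · exact Or.inr (by rw [h, neg_one_mul])
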